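/- Let $\mathbb F_q$ be a finite field with $q$ elements, let $\overline{\mathbb F_q}$ be an algebraic closure of it, and let $F$ be the Frobenius map of $GL_n(\overline{\mathbb F_q})$ that raises each matrix entry to the $q$-th power. A torus of $GL_n(\overline{\mathbb F_q})$ is a Zariski closed subgroup that is isomorphic, as an algebraic group, to $(\overline{\mathbb F_q}^{\times})^r$ for some $r\ge 0$; a maximal torus is a torus not properly contained in another torus. Let $T(n,q)$ denote the set of maximal tori $T$ of $GL_n(\overline{\mathbb F_q})$ that are $F$-stable, i.e. $F(T)=T$; this set is finite. Let $D_n$ be the group of invertible diagonal matrices. For each $T\in T(n,q)$ there is a unique partition of $n$, called the type of $T$, with the following property: for some $g\in GL_n(\overline{\mathbb F_q})$ with $T=gD_ng^{-1}$, the element $g^{-1}F(g)$ lies in the normalizer $N(D_n)$ and its image in $N(D_n)/D_n\cong S_n$ has this partition as its cycle type (fixed points counted as parts of size $1$). For $i\ge 1$, let $n_i(T)$ be the number of parts of size $i$ in the type of $T$. **Theorem.** As formal power series in $u$ with coefficients in the polynomial ring $\mathbb Q[x_1,x_2,\dots]$, $$1+\sum_{n\ge 1}\frac{u^n}{|GL(n,q)|}\sum_{T\in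 T(n,q)}\ \prod_{i\ge1} x_i^{n_i(T)}\;=\;\prod_{i\ge 1}\exp\!\left[\frac{x_i u^i}{(q^i-1)\,i}\right],$$ where $GL(n,q)=GL_n(\mathbb F_q)$ and the infinite product on the right converges coefficientwise. -/

import Mathlib

/-- The value at `g` of the regular function on `GL_n(K)` given by a polynomial `P` in the matrix
entries of `g` (the variables `some (i, j)`) and in `(det g)⁻¹` (the variable `none`). -/
noncomputable def regularEval {K : Type*} [Field K] {n : ℕ}
    (P : MvPolynomial (Option (Fin n × Fin n)) K) (g : Matrix.GeneralLinearGroup (Fin n) K) : K :=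
  MvPolynomial.eval
    (fun o => o.elim ((g.val.det)⁻¹) (fun ij => g.val ij.1 ij.2)) P

/-- `H` is Zariski closed in `GL_n(K)`: the common zero set of a family of regular functions. -/
def IsZariskiClosed {K : Type*} [Field K] {n : ℕ}
    (H : Subgroup (Matrix.GeneralLinearGroup (Fin n) K)) : Prop :=
  ∃ S : Set (MvPolynomial (Option (Fin n × Fin n)) K),
    ∀ g : Matrix.GeneralLinearGroup (Fin n) K, g ∈ H ↔ ∀ P ∈ S, regularEval P g = 0

/-- A homomorphism between subgroups of `GL_m(K)` and `GL_n(K)` is regular if every matrix entry of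
the image is the restriction of a regular function on `GL_m(K)`. -/
def IsRegularHom {K : Type*} [Field K] {m n : ℕ}
    {H : Subgroup (Matrix.GeneralLinearGroup (Fin m) K)}
    {H' : Subgroup (Matrix.GeneralLinearGroup (Fin n) K)} (φ : H →* H') : Prop :=
  ∀ i j : Fin n, ∃ P : MvPolynomial (Option (Fin m × Fin m)) K,
    ∀ h : H, (φ h).val.val i j = regularEval P h.val

/-- The group `D_n ≅ (K^×)^n` of invertible diagonal matrices in `GL_n(K)`. -/
noncomputable def diagonalSubgroup (n : ℕ) (K : Type*) [Field K] :
    Subgroup (Matrix.GeneralLinearGroup (Fin n) K) :=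
  (Units.map (Matrix.diagonalRingHom (Fin n) K).toMonoidHom).range

/-- A torus of `GL_n(K)`: a closed subgroup that is isomorphic, as an algebraic group, to
`D_r ≅ (K^×)^r` for some `r`. -/
def IsTorus {K : Type*} [Field K] {n : ℕ}
    (H : Subgroup (Matrix.GeneralLinearGroup (Fin n) K)) : Prop :=
  IsZariskiClosed H ∧ ∃ (r : ℕ) (φ : H ≃* diagonalSubgroup r K),
    IsRegularHom φ.toMonoidHom ∧ IsRegularHom φ.symm.toMonoidHom

/-- A maximal torus of `GL_n(K)`: a torus not properly contained in another torus. -/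
def IsMaximalTorus {K : Type*} [Field K] {n : ℕ}
    (T : Subgroup (Matrix.GeneralLinearGroup (Fin n) K)) : Prop :=
  Maximal IsTorus T

/-- The Frobenius map `F` of `GL_n(K)`, raising each matrix entry to the power `q = #k`. -/
noncomputable def frobeniusGL (k : Type*) [Field k] [Fintype k] {K : Type*} [Field K] [Algebra k K]
    (n : ℕ) : Matrix.GeneralLinearGroup (Fin n) K →* Matrix.GeneralLinearGroup (Fin n) K :=
  Matrix.GeneralLinearGroup.map (FiniteField.frobeniusAlgHom k K).toRingHom

/-- The set of `F`-stable maximal tori of `GL_n(K)`. -/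
def stableMaximalTori (k : Type*) [Field k] [Fintype k] (K : Type*) [Field K] [Algebra k K]
    (n : ℕ) : Set (Subgroup (Matrix.GeneralLinearGroup (Fin n) K)) :=
  {T | IsMaximalTorus T ∧ T.map (frobeniusGL k n) = T}

/-- `T` has type `lam`: writing `T = g D_n g⁻¹`, the element `g⁻¹ F(g)` of the normalizer of `D_n`
maps to a permutation of cycle type `lam` in the Weyl group `N(D_n) / D_n = S_n`. (The cycle type
includes the fixed points, as parts of size `1`.) -/
def IsTorusOfType (k : Type*) [Field k] [Fintype k] {K : Type*} [Field K] [Algebra k K] {n : ℕ}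
    (T : Subgroup (Matrix.GeneralLinearGroup (Fin n) K)) (lam : n.Partition) : Prop :=
  ∃ (g : Matrix.GeneralLinearGroup (Fin n) K) (σ : Equiv.Perm (Fin n)) (d : Fin n → K),
    T = (diagonalSubgroup n K).map (MulAut.conj g).toMonoidHom ∧
    (g⁻¹ * frobeniusGL k n g).val = σ.permMatrix K * Matrix.diagonal d ∧
    σ.partition.parts = lam.parts

open Classical in
/-- The type of `T`. (The default value is never taken on `F`-stable maximal tori, on which the
type exists and is unique.) -/
noncomputable def torusType (k : Type*) [Field k] [Fintype k] {K : Type*} [Field K] [Algebra k K]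
    {n : ℕ} (T : Subgroup (Matrix.GeneralLinearGroup (Fin n) K)) : n.Partition :=
  if h : ∃ lam : n.Partition, IsTorusOfType k T lam then h.choose else Nat.Partition.indiscrete n

/-- `n_i(T)`, the number of parts of size `i` of the type of `T`. -/
noncomputable def numParts (k : Type*) [Field k] [Fintype k] {K : Type*} [Field K] [Algebra k K]
    {n : ℕ} (T : Subgroup (Matrix.GeneralLinearGroup (Fin n) K)) (i : ℕ) : ℕ :=
  (torusType k T).parts.count i

/-- The coefficient `(1 / |GL(n,q)|) ∑_T ∏_i x_i ^ n_i(T)` in `ℚ[x₁, x₂, …]`, where `T` runs over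
the `F`-stable maximal tori of `GL_n(K)`. -/
noncomputable def toriCycleIndex (k : Type*) [Field k] [Fintype k] (K : Type*) [Field K]
    [Algebra k K] (n : ℕ) : MvPolynomial ℕ+ ℚ :=
  MvPolynomial.C (1 / (Nat.card (Matrix.GeneralLinearGroup (Fin n) k) : ℚ)) *
    ∑ᶠ T ∈ stableMaximalTori k K n, ∏ᶠ i : ℕ+, MvPolynomial.X i ^ numParts k T i

open scoped PowerSeries.WithPiTopology

/-! Call (σ, g) a frame if F(g) = g P_σ, where P_σ is the permutation matrix of σ. Each coefficient
of the series comes from counting frames in two ways, with weight ∏ x_l / (q^l - 1) over the cycle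
lengths l of σ, fixed points included.

For fixed σ, Lang's theorem makes the admissible g a coset of GL_n(k)
(`nonempty_equiv_frobeniusGL_eq_mul`), so the total is |GL(n,q)| ∑_σ ∏ x_l / (q^l - 1).

On the other hand, a frame determines the F-stable maximal torus g D_n g⁻¹, whose type is the cycle
type of σ, and every F-stable maximal torus arises in this way. The frames over the same torus have
second components g diag(u) P_τ, with τ arbitrary and u(σ i)^q = u(i)
(`nonempty_equiv_frobeniusFrames_fiber`). Such a u amounts to one element of 𝔽_{q^l}^× for each
l-cycle (`card_semilinear_units`). The fibre thus has n! ∏ (q^l - 1) elements, the weight cancels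
the product, and the total is n! ∑_T ∏ x_i^{n_i(T)}.

Hence the coefficient of u^n is the cycle index of S_n evaluated at x_l / (q^l - 1), and the product
formula is the exponential formula.

Two inputs come from algebraic groups. Lang's theorem rests on `span_fixedPoints_eq_top`. Maximal
tori are exactly the conjugates of D_n (`isMaximalTorus_iff`), because elements of a torus over the
closure of a finite field satisfy x^(q^m) = x and so are semisimple. -/

/-! ### Fixed points of Frobenius and of semilinear maps -/

section FrobeniusFixedPoints

variable (k : Type*) [Field k] [Fintype k] {K : Type*} [Field K] [Algebra k K]

/-- Finitely many elements of an algebraic extension of a finite field lie in a finite subfield. -/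
theorem exists_intermediateField_finite_of_finite [Algebra.IsAlgebraic k K] (s : Set K)
    (hs : s.Finite) : ∃ L : IntermediateField k K, Finite L ∧ s ⊆ L := by
  have := hs.to_subtype
  have : FiniteDimensional k (IntermediateField.adjoin k s) :=
    IntermediateField.finiteDimensional_adjoin fun x _ => Algebra.IsIntegral.isIntegral x
  exact ⟨IntermediateField.adjoin k s, Module.finite_of_finite k,
    IntermediateField.subset_adjoin k s⟩

theorem exists_pow_card_pow_eq [Algebra.IsAlgebraic k K] (s : Set K) (hs : s.Finite) :
    ∃ m : ℕ, 0 < m ∧ ∀ x ∈ s, x ^ Fintype.card k ^ m = x := by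
  obtain ⟨L, hL, hsL⟩ := exists_intermediateField_finite_of_finite k s hs
  have := Fintype.ofFinite L
  have : FiniteDimensional k L := Module.Finite.of_finite
  refine ⟨Module.finrank k L, Module.finrank_pos, fun x hx => ?_⟩
  have := FiniteField.pow_card (⟨x, hsL hx⟩ : L)
  rw [Module.card_eq_pow_finrank (K := k)] at this
  exact congrArg Subtype.val this

theorem separable_X_pow_card_pow_sub_X {m : ℕ} (hm : 0 < m) :
    (Polynomial.X ^ Fintype.card k ^ m - Polynomial.X : Polynomial K).Separable := by
  obtain ⟨p, hp⟩ := CharP.exists k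
  have : CharP K p := charP_of_injective_algebraMap (algebraMap k K).injective p
  obtain ⟨n, -, h⟩ := FiniteField.card k p
  refine galois_poly_separable p _ (dvd_pow ?_ hm.ne')
  rw [h]
  exact dvd_pow_self p n.2.ne'

variable (K) in
/-- The set of `x` with `x ^ (q ^ m) = x`. -/
noncomputable def frobeniusFixedPoints (m : ℕ) : Finset K :=
  letI := Classical.decEq K
  (Polynomial.X ^ Fintype.card k ^ m - Polynomial.X : Polynomial K).roots.toFinset

theorem mem_frobeniusFixedPoints {m : ℕ} (hm : 0 < m) {x : K} :
    x ∈ frobeniusFixedPoints k K m ↔ x ^ Fintype.card k ^ m = x := by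
  let _ := Classical.decEq K
  rw [frobeniusFixedPoints, Multiset.mem_toFinset,
    Polynomial.mem_roots (separable_X_pow_card_pow_sub_X k hm).ne_zero]
  simp [sub_eq_zero]

theorem card_frobeniusFixedPoints [IsAlgClosed K] {m : ℕ} (hm : 0 < m) :
    (frobeniusFixedPoints k K m).card = Fintype.card k ^ m := by
  classical
  have hsep := separable_X_pow_card_pow_sub_X k (K := K) hm
  have h := Polynomial.card_rootSet_eq_natDegree (F := K) (K := K) hsep (IsAlgClosed.splits _)
  rw [FiniteField.X_pow_card_pow_sub_X_natDegree_eq _ hm.ne' Fintype.one_lt_card] at h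
  rw [← h, ← Set.toFinset_card]
  congr 1
  ext x
  rw [mem_frobeniusFixedPoints k hm, Set.mem_toFinset, Polynomial.mem_rootSet_of_ne hsep.ne_zero]
  simp [sub_eq_zero]

/-- The elements of k already supply q roots of X^q - X, so there is no room for another. -/
theorem mem_range_algebraMap_of_pow_card_eq {x : K} (hx : x ^ Fintype.card k = x) :
    x ∈ Set.range (algebraMap k K) := by
  classical
  by_contra h
  have hsep := separable_X_pow_card_pow_sub_X k (K := K) one_pos
  have hdeg := FiniteField.X_pow_card_pow_sub_X_natDegree_eq K (p := Fintype.card k)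
    one_ne_zero Fintype.one_lt_card
  refine hsep.ne_zero (Polynomial.eq_zero_of_natDegree_lt_card_of_eval_eq_zero' _
    (insert x (Finset.univ.image (algebraMap k K))) ?_ ?_)
  · intro y hy
    rw [Finset.mem_insert, Finset.mem_image] at hy
    obtain rfl | ⟨z, -, rfl⟩ := hy
    · simp [hx]
    · simp [← map_pow, FiniteField.pow_card]
  · rw [hdeg, Finset.card_insert_of_notMem (by simpa using h),
      Finset.card_image_of_injective _ (algebraMap k K).injective, Finset.card_univ]
    simp

theorem pow_card_injective : Function.Injective fun x : K => x ^ Fintype.card k :=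
  (FiniteField.frobeniusAlgHom k K).toRingHom.injective

/-- If a Frobenius-semilinear additive map has only periodic points, its fixed points span. -/
theorem span_fixedPoints_eq_top [IsAlgClosed K] {V : Type*} [AddCommGroup V] [Module K V]
    (φ : V →+ V) (hφ : ∀ (c : K) (v : V), φ (c • v) = c ^ Fintype.card k • φ v)
    (hper : ∀ v, v ∈ Function.periodicPts φ) :
    Submodule.span K {v | φ v = v} = ⊤ := by
  rw [Submodule.eq_top_iff']
  by_contra! ⟨v, hv⟩
  -- If the fixed points span too little, some functional f kills them but not v.
  obtain ⟨f, hfv, hf⟩ := Submodule.exists_le_ker_of_notMem hv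
  obtain ⟨m, hm, hmv⟩ := hper v
  have hq : 1 < Fintype.card k := Fintype.one_lt_card
  have hsmul (c : K) (j : ℕ) (w : V) : φ^[j] (c • w) = c ^ Fintype.card k ^ j • φ^[j] w := by
    induction j generalizing c w with
    | zero => simp
    | succ j ih => rw [Function.iterate_succ_apply, hφ, ih, ← pow_mul, ← pow_succ',
        Function.iterate_succ_apply]
  -- p(c) = f(∑_{j<m} φ^j(c v)), with m a period of v; its linear coefficient is f(v) ≠ 0.
  let p : Polynomial K := ∑ j ∈ Finset.range m,
    Polynomial.C (f (φ^[j] v)) * Polynomial.X ^ Fintype.card k ^ j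
  have hp : p.coeff 1 = f v := by
    simp only [p, Polynomial.finsetSum_coeff, Polynomial.coeff_C_mul, Polynomial.coeff_X_pow]
    rw [Finset.sum_eq_single 0]
    · simp
    · intro j _ hj
      rw [if_neg, mul_zero]
      exact (Nat.one_lt_pow hj hq).ne
    · intro h
      exact absurd (Finset.mem_range.2 hm) h
  have hp0 : p ≠ 0 := fun h => hfv (by rw [← hp, h, Polynomial.coeff_zero])
  refine hp0 (Polynomial.eq_zero_of_natDegree_lt_card_of_eval_eq_zero' p
    (frobeniusFixedPoints k K m) ?_ ?_)
  · intro c hc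
    rw [mem_frobeniusFixedPoints k hm] at hc
    -- For c^(q^m) = c the vector c v also has period m, so its orbit sum is fixed by φ and p(c) =
    -- 0.
    have hfix : ∑ j ∈ Finset.range m, φ^[j] (c • v) ∈ f.ker := by
      refine hf (Submodule.subset_span ?_)
      simp only [Set.mem_ofPred_eq, map_sum, ← Function.iterate_succ_apply' φ]
      refine add_right_cancel (b := φ^[0] (c • v)) ?_
      rw [← Finset.sum_range_succ' (fun j => φ^[j] (c • v)), Finset.sum_range_succ, hsmul, hc,
        hmv.eq, Function.iterate_zero_apply]
    rw [LinearMap.mem_ker, map_sum] at hfix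
    rw [← hfix]
    simp only [p, Polynomial.eval_finsetSum, hsmul, map_smul, smul_eq_mul]
    exact Finset.sum_congr rfl fun j _ => by
      rw [Polynomial.eval_C_mul, Polynomial.eval_pow, Polynomial.eval_X, mul_comm]
  -- There are q^m such c, but p has degree at most q^(m-1).
  · rw [card_frobeniusFixedPoints k hm]
    refine Nat.lt_of_le_pred (by positivity) (Polynomial.natDegree_sum_le_of_forall_le _ _ ?_)
    intro j hj
    refine (Polynomial.natDegree_C_mul_X_pow_le _ _).trans (Nat.le_pred_of_lt ?_)
    exact Nat.pow_lt_pow_right hq (Finset.mem_range.1 hj)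

end FrobeniusFixedPoints

/-! ### Lang's theorem for GL_n -/

section Lang

variable (k : Type*) [Field k] [Fintype k] {K : Type*} [Field K] [Algebra k K] {n : ℕ}

/-- A spanning set of `K ^ n` contains the columns of an invertible matrix. -/
theorem exists_generalLinearGroup_col_mem (S : Set (Fin n → K))
    (hS : Submodule.span K S = ⊤) :
    ∃ g : Matrix.GeneralLinearGroup (Fin n) K, ∀ j, g.val.col j ∈ S := by
  let b := Module.Basis.ofSpan hS.ge
  have := FiniteDimensional.fintypeBasisIndex b
  have e := b.indexEquiv (Pi.basisFun K (Fin n))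
  let b' := b.reindex e
  let A : Matrix (Fin n) (Fin n) K := Matrix.of fun i j => b' j i
  have hA : A.col = b' := rfl
  have hu : IsUnit A := by
    rw [← Matrix.linearIndependent_cols_iff_isUnit, hA]
    exact b'.linearIndependent
  obtain ⟨g, hg⟩ := hu
  refine ⟨g, fun j => ?_⟩
  rw [hg, hA, Module.Basis.reindex_apply]
  exact Module.Basis.ofSpan_subset _ ⟨_, rfl⟩

@[simp]
theorem frobeniusGL_apply (g : Matrix.GeneralLinearGroup (Fin n) K) (i j : Fin n) :
    (frobeniusGL k n g).val i j = g.val i j ^ Fintype.card k := rfl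

/-- The semilinear map `v ↦ A F(v)` on `K ^ n`. -/
noncomputable def frobeniusMulVec (A : Matrix (Fin n) (Fin n) K) : (Fin n → K) →+ (Fin n → K) :=
  A.mulVecLin.toAddMonoidHom.comp
    ((FiniteField.frobeniusAlgHom k K).toRingHom.toAddMonoidHom.compLeft (Fin n))

theorem frobeniusMulVec_apply (A : Matrix (Fin n) (Fin n) K) (v : Fin n → K) (i : Fin n) :
    frobeniusMulVec k A v i = ∑ j, A i j * v j ^ Fintype.card k := rfl

theorem frobeniusMulVec_smul (A : Matrix (Fin n) (Fin n) K) (c : K) (v : Fin n → K) :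
    frobeniusMulVec k A (c • v) = c ^ Fintype.card k • frobeniusMulVec k A v := by
  ext i
  simp only [frobeniusMulVec_apply, Pi.smul_apply, smul_eq_mul, Finset.mul_sum, mul_pow]
  exact Finset.sum_congr rfl fun j _ => by ring

theorem frobeniusMulVec_injective {A : Matrix (Fin n) (Fin n) K} (hA : IsUnit A) :
    Function.Injective (frobeniusMulVec k A) := by
  have h1 : Function.Injective A.mulVec := Matrix.mulVec_injective_of_isUnit hA
  intro v w h
  have h2 := h1 h
  funext i
  exact pow_card_injective k (congrFun h2 i)

/-- The entries of A and v lie in a finite field L. The map preserves the finite set L^n and is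
injective there, so it permutes it. -/
theorem mem_periodicPts_frobeniusMulVec [Algebra.IsAlgebraic k K] {A : Matrix (Fin n) (Fin n) K}
    (hA : IsUnit A) (v : Fin n → K) : v ∈ Function.periodicPts (frobeniusMulVec k A) := by
  obtain ⟨L, hL, hs⟩ := exists_intermediateField_finite_of_finite k
    (Set.range (fun p : Fin n × Fin n => A p.1 p.2) ∪ Set.range v)
    ((Set.finite_range _).union (Set.finite_range _))
  have hA' (i j) : A i j ∈ L := hs (Or.inl ⟨(i, j), rfl⟩)
  have hv (i) : v i ∈ L := hs (Or.inr ⟨i, rfl⟩)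
  let ψ : (Fin n → L) → (Fin n → L) := fun w i => ⟨frobeniusMulVec k A (fun j => w j) i, by
    rw [frobeniusMulVec_apply]
    exact sum_mem fun j _ => mul_mem (hA' i j) (pow_mem (w j).2 _)⟩
  let ι : (Fin n → L) → (Fin n → K) := fun w j => w j
  have hψ (w) : ι (ψ w) = frobeniusMulVec k A (ι w) := rfl
  have hι : Function.Injective ι := fun w w' h => funext fun i => Subtype.ext (congrFun h i)
  have hinj : Function.Injective ψ := fun w w' h =>
    hι (frobeniusMulVec_injective k hA (by rw [← hψ, ← hψ, h]))
  obtain ⟨m, hm, h⟩ := hinj.mem_periodicPts (fun i => ⟨v i, hv i⟩)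
  refine ⟨m, hm, ?_⟩
  have hsemi : Function.Semiconj ι ψ (frobeniusMulVec k A) := hψ
  have := (hsemi.iterate_right m) (fun i => ⟨v i, hv i⟩)
  rw [h.eq] at this
  exact this.symm

theorem span_frobeniusMulVec_fixed_eq_top [Algebra.IsAlgebraic k K] [IsAlgClosed K]
    {A : Matrix (Fin n) (Fin n) K} (hA : IsUnit A) :
    Submodule.span K {v | frobeniusMulVec k A v = v} = ⊤ :=
  span_fixedPoints_eq_top k _ (frobeniusMulVec_smul k A) (mem_periodicPts_frobeniusMulVec k hA)

/-- **Lang's theorem** for `GL_n` over the algebraic closure of a finite field. -/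
theorem exists_frobeniusGL_eq_mul [Algebra.IsAlgebraic k K] [IsAlgClosed K]
    (A : Matrix.GeneralLinearGroup (Fin n) K) :
    ∃ g : Matrix.GeneralLinearGroup (Fin n) K, frobeniusGL k n g = g * A := by
  obtain ⟨g, hg⟩ := exists_generalLinearGroup_col_mem _
    (span_frobeniusMulVec_fixed_eq_top k A.isUnit)
  -- The columns of g are fixed by v ↦ A F(v); the required solution is then g⁻¹.
  have h : A * frobeniusGL k n g = g := by
    ext i j
    exact congrFun (hg j) i
  refine ⟨g⁻¹, ?_⟩
  rw [map_inv, eq_inv_mul_of_mul_eq h, mul_inv_rev, inv_inv]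

end Lang

/-! ### The diagonal subgroup and its normalizer -/

section DiagonalSubgroup

variable {K : Type*} [Field K] {n : ℕ}

/-- The invertible diagonal matrix with diagonal entries `u`. -/
noncomputable def diagonalGL (u : Fin n → Kˣ) : Matrix.GeneralLinearGroup (Fin n) K :=
  Units.map (Matrix.diagonalRingHom (Fin n) K).toMonoidHom (MulEquiv.piUnits.symm u)

theorem val_diagonalGL (u : Fin n → Kˣ) :
    (diagonalGL u).val = Matrix.diagonal fun i => (u i : K) := rfl

theorem diagonalGL_mem (u : Fin n → Kˣ) : diagonalGL u ∈ diagonalSubgroup n K := ⟨_, rfl⟩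

theorem mem_diagonalSubgroup_iff_exists {x : Matrix.GeneralLinearGroup (Fin n) K} :
    x ∈ diagonalSubgroup n K ↔ ∃ u, diagonalGL u = x := by
  constructor
  · rintro ⟨u, rfl⟩
    exact ⟨MulEquiv.piUnits u, by rw [diagonalGL, MulEquiv.symm_apply_apply]⟩
  · rintro ⟨u, rfl⟩
    exact diagonalGL_mem u

theorem mem_diagonalSubgroup_iff {x : Matrix.GeneralLinearGroup (Fin n) K} :
    x ∈ diagonalSubgroup n K ↔ ∀ i j, i ≠ j → x.val i j = 0 := by
  constructor
  · rw [mem_diagonalSubgroup_iff_exists]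
    rintro ⟨u, rfl⟩ i j hij
    rw [val_diagonalGL, Matrix.diagonal_apply_ne _ hij]
  · intro h
    have hd : x.val = Matrix.diagonal fun i => x.val i i := by
      ext i j
      by_cases hij : i = j
      · subst hij; simp
      · rw [h i j hij, Matrix.diagonal_apply_ne _ hij]
    have hdet : x.val.det ≠ 0 := (Matrix.isUnit_iff_isUnit_det _ |>.1 x.isUnit).ne_zero
    rw [hd, Matrix.det_diagonal, Finset.prod_ne_zero_iff] at hdet
    rw [mem_diagonalSubgroup_iff_exists]
    refine ⟨fun i => Units.mk0 _ (hdet i (Finset.mem_univ i)), Units.ext ?_⟩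
    exact hd.symm

theorem mem_map_conj_iff {G : Type*} [Group G] {D : Subgroup G} {g x : G} :
    x ∈ D.map (MulAut.conj g).toMonoidHom ↔ g⁻¹ * x * g ∈ D := by
  constructor
  · rintro ⟨y, hy, rfl⟩
    simpa [mul_assoc] using hy
  · intro h
    exact ⟨_, h, by simp [mul_assoc]⟩

theorem map_conj_mul {G : Type*} [Group G] (D : Subgroup G) (g h : G) :
    D.map (MulAut.conj (g * h)).toMonoidHom =
      (D.map (MulAut.conj h).toMonoidHom).map (MulAut.conj g).toMonoidHom := by
  ext x
  simp only [mem_map_conj_iff, mul_inv_rev, mul_assoc]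

theorem map_conj_eq_iff {G : Type*} [Group G] (D : Subgroup G) (g h : G) :
    D.map (MulAut.conj g).toMonoidHom = D.map (MulAut.conj h).toMonoidHom ↔
      D.map (MulAut.conj (g⁻¹ * h)).toMonoidHom = D := by
  have hinj : Function.Injective (MulAut.conj g).toMonoidHom := (MulAut.conj g).injective
  rw [eq_comm, ← (Subgroup.map_injective hinj).eq_iff (b := D), ← map_conj_mul,
    mul_inv_cancel_left]

theorem exists_diagonalGL_injective (n : ℕ) (K : Type*) [Field K] [Infinite K] :
    ∃ t : Fin n → Kˣ, Function.Injective t := by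
  have : Infinite Kˣ := by
    have := (Set.finite_singleton (0 : K)).infinite_compl.to_subtype
    exact Infinite.of_injective (fun m : ({0}ᶜ : Set K) => Units.mk0 m.1 m.2)
      fun a b h => Subtype.ext (congrArg Units.val h)
  exact ⟨fun i => Infinite.natEmbedding Kˣ i,
    fun i j h => Fin.ext ((Infinite.natEmbedding Kˣ).injective h)⟩

/-- A matrix that commutes with a diagonal matrix with distinct entries is diagonal. -/
theorem mem_diagonalSubgroup_of_commute {t : Fin n → Kˣ} (ht : Function.Injective t)
    {x : Matrix.GeneralLinearGroup (Fin n) K} (h : Commute (diagonalGL t) x) :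
    x ∈ diagonalSubgroup n K := by
  rw [mem_diagonalSubgroup_iff]
  intro i j hij
  have h1 := congrArg (fun y => y.val i j) h.eq
  simp only [Units.val_mul, val_diagonalGL, Matrix.diagonal_mul, Matrix.mul_diagonal] at h1
  by_contra h0
  rw [mul_comm, mul_right_inj' h0, Units.val_inj] at h1
  exact hij (ht h1)

theorem commute_of_mem_map_conj_diagonalSubgroup {a x y : Matrix.GeneralLinearGroup (Fin n) K}
    (hx : x ∈ (diagonalSubgroup n K).map (MulAut.conj a).toMonoidHom)
    (hy : y ∈ (diagonalSubgroup n K).map (MulAut.conj a).toMonoidHom) : Commute x y := by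
  obtain ⟨_, ⟨u, rfl⟩, rfl⟩ := hx
  obtain ⟨_, ⟨v, rfl⟩, rfl⟩ := hy
  exact ((Commute.all u v).map _).map _

/-- The larger group is commutative and contains a diagonal matrix with distinct entries, whose
centralizer is D_n. -/
theorem eq_of_diagonalSubgroup_le_map_conj [Infinite K]
    {a : Matrix.GeneralLinearGroup (Fin n) K}
    (h : diagonalSubgroup n K ≤ (diagonalSubgroup n K).map (MulAut.conj a).toMonoidHom) :
    (diagonalSubgroup n K).map (MulAut.conj a).toMonoidHom = diagonalSubgroup n K := by
  refine le_antisymm (fun x hx => ?_) h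
  obtain ⟨t, ht⟩ := exists_diagonalGL_injective n K
  exact mem_diagonalSubgroup_of_commute ht
    (commute_of_mem_map_conj_diagonalSubgroup (h (diagonalGL_mem t)) hx)

theorem eq_of_map_conj_le_map_conj [Infinite K] {a b : Matrix.GeneralLinearGroup (Fin n) K}
    (h : (diagonalSubgroup n K).map (MulAut.conj a).toMonoidHom ≤
      (diagonalSubgroup n K).map (MulAut.conj b).toMonoidHom) :
    (diagonalSubgroup n K).map (MulAut.conj a).toMonoidHom =
      (diagonalSubgroup n K).map (MulAut.conj b).toMonoidHom := by
  rw [map_conj_eq_iff]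
  refine eq_of_diagonalSubgroup_le_map_conj fun x hx => ?_
  rw [mem_map_conj_iff]
  have h1 := h (Subgroup.mem_map_of_mem _ hx)
  rw [mem_map_conj_iff] at h1
  simpa [mul_assoc] using h1

/-- `a` is monomial with underlying permutation `σ`: its nonzero entries are at `(i, σ i)`. -/
def IsMonomialMatrix (σ : Equiv.Perm (Fin n)) (a : Matrix (Fin n) (Fin n) K) : Prop :=
  ∀ i j, a i j ≠ 0 → σ i = j

theorem permMatrix_mul_diagonal_apply (σ : Equiv.Perm (Fin n)) (d : Fin n → K) (i j : Fin n) :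
    (σ.permMatrix K * Matrix.diagonal d) i j = if σ i = j then d j else 0 := by
  simp [Matrix.mul_diagonal, PEquiv.toMatrix_apply, Equiv.toPEquiv_apply]

theorem IsMonomialMatrix.eq_permMatrix_mul {σ : Equiv.Perm (Fin n)} {a : Matrix (Fin n) (Fin n) K}
    (h : IsMonomialMatrix σ a) :
    a = σ.permMatrix K * Matrix.diagonal fun j => a (σ.symm j) j := by
  ext i j
  rw [permMatrix_mul_diagonal_apply]
  split_ifs with hij
  · rw [← hij, Equiv.symm_apply_apply]
  · by_contra h0
    exact hij (h i j h0)

theorem isMonomialMatrix_permMatrix_mul (σ : Equiv.Perm (Fin n)) (d : Fin n → K) :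
    IsMonomialMatrix σ (σ.permMatrix K * Matrix.diagonal d) := by
  intro i j h
  rw [permMatrix_mul_diagonal_apply] at h
  by_contra h0
  exact h (if_neg h0)

theorem IsMonomialMatrix.apply_ne_zero {σ : Equiv.Perm (Fin n)}
    {a : Matrix.GeneralLinearGroup (Fin n) K} (h : IsMonomialMatrix σ a.val) (i : Fin n) :
    a.val i (σ i) ≠ 0 := by
  intro h0
  refine (Matrix.isUnit_iff_isUnit_det _ |>.1 a.isUnit).ne_zero
    (Matrix.det_eq_zero_of_row_eq_zero i fun j => ?_)
  by_contra h1
  rw [← h i j h1] at h1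
  exact h1 h0

theorem IsMonomialMatrix.apply_eq_zero {σ : Equiv.Perm (Fin n)}
    {a : Matrix (Fin n) (Fin n) K} (h : IsMonomialMatrix σ a) {i j : Fin n} (hij : σ i ≠ j) :
    a i j = 0 := by
  by_contra h0
  exact hij (h i j h0)

theorem IsMonomialMatrix.unique {σ τ : Equiv.Perm (Fin n)}
    {a : Matrix.GeneralLinearGroup (Fin n) K} (h : IsMonomialMatrix σ a.val)
    (h' : IsMonomialMatrix τ a.val) : σ = τ :=
  Equiv.ext fun i => (h' i _ (h.apply_ne_zero i)).symm

theorem IsMonomialMatrix.mul_apply {σ : Equiv.Perm (Fin n)} {a : Matrix (Fin n) (Fin n) K}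
    (h : IsMonomialMatrix σ a) (b : Matrix (Fin n) (Fin n) K) (i j : Fin n) :
    (a * b) i j = a i (σ i) * b (σ i) j := by
  rw [Matrix.mul_apply, Finset.sum_eq_single (σ i)]
  · intro l _ hl
    rw [h.apply_eq_zero hl.symm, zero_mul]
  · simp

/-- Row i of a leads to column σ i, which b then sends to τ (σ i). Passing to permutations therefore
reverses products, here and in `permGL_mul`. -/
theorem IsMonomialMatrix.mul {σ τ : Equiv.Perm (Fin n)} {a b : Matrix (Fin n) (Fin n) K}
    (ha : IsMonomialMatrix σ a) (hb : IsMonomialMatrix τ b) : IsMonomialMatrix (τ * σ) (a * b) := by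
  intro i j h
  rw [ha.mul_apply] at h
  exact hb _ _ (right_ne_zero_of_mul h)

theorem IsMonomialMatrix.mul_diagonalGL {σ : Equiv.Perm (Fin n)}
    {a : Matrix.GeneralLinearGroup (Fin n) K} (h : IsMonomialMatrix σ a.val) (u : Fin n → Kˣ) :
    a * diagonalGL u = diagonalGL (u ∘ σ) * a := by
  ext i j
  simp only [Units.val_mul, val_diagonalGL, Matrix.diagonal_mul, Matrix.mul_diagonal,
    Function.comp_apply]
  by_cases hij : σ i = j
  · rw [hij, mul_comm]
  · rw [h.apply_eq_zero hij, zero_mul, mul_zero]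

/-- Monomial matrices normalize the diagonal subgroup. -/
theorem IsMonomialMatrix.map_conj_diagonalSubgroup {σ : Equiv.Perm (Fin n)}
    {a : Matrix.GeneralLinearGroup (Fin n) K} (h : IsMonomialMatrix σ a.val) :
    (diagonalSubgroup n K).map (MulAut.conj a).toMonoidHom = diagonalSubgroup n K := by
  ext x
  rw [mem_map_conj_iff]
  simp only [mem_diagonalSubgroup_iff_exists]
  constructor
  · rintro ⟨u, hu⟩
    refine ⟨u ∘ σ, ?_⟩
    rw [← mul_left_inj a, ← h.mul_diagonalGL, hu]
    simp [mul_assoc]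
  · rintro ⟨u, rfl⟩
    refine ⟨u ∘ σ.symm, ?_⟩
    rw [← mul_right_inj a, h.mul_diagonalGL]
    simp [mul_assoc, Function.comp_assoc]

/-- The normalizer of the diagonal subgroup consists of monomial matrices. -/
theorem exists_isMonomialMatrix_of_map_conj [Infinite K]
    {a : Matrix.GeneralLinearGroup (Fin n) K}
    (h : (diagonalSubgroup n K).map (MulAut.conj a).toMonoidHom = diagonalSubgroup n K) :
    ∃ σ : Equiv.Perm (Fin n), IsMonomialMatrix σ a.val := by
  obtain ⟨t, ht⟩ := exists_diagonalGL_injective n K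
  have hs : MulAut.conj a (diagonalGL t) ∈ diagonalSubgroup n K := by
    rw [← h]
    exact Subgroup.mem_map_of_mem _ (diagonalGL_mem t)
  obtain ⟨s, hs⟩ := mem_diagonalSubgroup_iff_exists.1 hs
  have hst : a * diagonalGL t = diagonalGL s * a := by rw [hs]; simp
  -- Since t is injective, this leaves at most one nonzero entry in each row; invertibility gives at
  -- least one in each row and column.
  have hne (i j) (hij : a.val i j ≠ 0) : t j = s i := by
    have h1 := congrArg (fun y => y.val i j) hst
    simp only [Units.val_mul, val_diagonalGL, Matrix.diagonal_mul, Matrix.mul_diagonal] at h1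
    rwa [mul_comm, mul_left_inj' hij, Units.val_inj] at h1
  have hdet : a.val.det ≠ 0 := (Matrix.isUnit_iff_isUnit_det _ |>.1 a.isUnit).ne_zero
  have hrow (i) : ∃ j, a.val i j ≠ 0 := by
    by_contra! h0
    exact hdet (Matrix.det_eq_zero_of_row_eq_zero i h0)
  have hcol (j) : ∃ i, a.val i j ≠ 0 := by
    by_contra! h0
    exact hdet (Matrix.det_eq_zero_of_column_eq_zero j h0)
  choose f hf using hrow
  have hf' (i j) (hij : a.val i j ≠ 0) : f i = j := ht ((hne _ _ (hf i)).trans (hne i j hij).symm)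
  have hsurj : Function.Surjective f := fun j => (hcol j).imp fun i hi => hf' i j hi
  exact ⟨Equiv.ofBijective f (Finite.surjective_iff_bijective.1 hsurj), hf'⟩

end DiagonalSubgroup

/-! ### Maximal tori are the conjugates of D_n -/

section Tori

variable {K : Type*} [Field K] {n : ℕ}

theorem exists_regularEval_eq (a b : Matrix (Fin n) (Fin n) K) (i j : Fin n) :
    ∃ P : MvPolynomial (Option (Fin n × Fin n)) K,
      ∀ x : Matrix.GeneralLinearGroup (Fin n) K, regularEval P x = (a * x.val * b) i j := by
  refine ⟨∑ l, (∑ m, MvPolynomial.C (a i m) * MvPolynomial.X (some (m, l))) *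
    MvPolynomial.C (b l j), fun x => ?_⟩
  simp [regularEval, Matrix.mul_apply]

/-- The defining equations are the off-diagonal entries of g⁻¹ x g, and conjugation by g is the
isomorphism with D_n. -/
theorem isTorus_map_conj_diagonalSubgroup (g : Matrix.GeneralLinearGroup (Fin n) K) :
    IsTorus ((diagonalSubgroup n K).map (MulAut.conj g).toMonoidHom) := by
  refine ⟨?_, n, ((MulAut.conj g).subgroupMap (diagonalSubgroup n K)).symm, ?_, ?_⟩
  · choose P hP using exists_regularEval_eq (g⁻¹).val g.val
    refine ⟨{Q | ∃ i j, i ≠ j ∧ P i j = Q}, fun x => ?_⟩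
    rw [mem_map_conj_iff, mem_diagonalSubgroup_iff]
    constructor
    · rintro h _ ⟨i, j, hij, rfl⟩
      rw [hP]
      exact h i j hij
    · intro h i j hij
      rw [← h _ ⟨i, j, hij, rfl⟩, hP]
      rfl
  · intro i j
    obtain ⟨P, hP⟩ := exists_regularEval_eq (g⁻¹).val g.val i j
    refine ⟨P, fun x => ?_⟩
    rw [hP]
    obtain ⟨y, rfl⟩ := ((MulAut.conj g).subgroupMap (diagonalSubgroup n K)).surjective x
    refine (congrArg (fun z : diagonalSubgroup n K => z.val.val i j)
      (MulEquiv.symm_apply_apply ((MulAut.conj g).subgroupMap (diagonalSubgroup n K)) y)).trans ?_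
    simp [mul_assoc]
  · intro i j
    obtain ⟨P, hP⟩ := exists_regularEval_eq g.val (g⁻¹).val i j
    refine ⟨P, fun x => ?_⟩
    rw [hP]
    rfl

/-- Over the algebraic closure of a finite field every torus is diagonalizable. -/
theorem IsTorus.exists_le_map_conj (k : Type*) [Field k] [Fintype k] [Algebra k K]
    [Algebra.IsAlgebraic k K] [IsAlgClosed K]
    {T : Subgroup (Matrix.GeneralLinearGroup (Fin n) K)} (hT : IsTorus T) :
    ∃ g, T ≤ (diagonalSubgroup n K).map (MulAut.conj g).toMonoidHom := by
  obtain ⟨-, r, φ, -, -⟩ := hT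
  let f : T → Module.End K (Fin n → K) := fun h => Matrix.toLin' h.val.val
  have hcomm : Pairwise fun h h' => Commute (f h) (f h') := by
    intro h h' _
    have h1 : φ h * φ h' = φ h' * φ h := by
      obtain ⟨u, hu⟩ := (φ h).2
      obtain ⟨v, hv⟩ := (φ h').2
      apply Subtype.ext
      rw [Subgroup.coe_mul, Subgroup.coe_mul, ← hu, ← hv, ← map_mul, ← map_mul, mul_comm]
    rw [← map_mul, ← map_mul] at h1
    have h2 := congrArg (fun y : T => y.val.val) (φ.injective h1)
    simp only [Subgroup.coe_mul, Units.val_mul] at h2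
    rw [Commute, SemiconjBy, Module.End.mul_eq_comp, Module.End.mul_eq_comp, ← Matrix.toLin'_mul,
      ← Matrix.toLin'_mul, h2]
  -- The diagonal matrix φ h has entries in a finite field, so h^(q^m) = h for some m > 0. Thus h is
  -- a root of a separable polynomial. Only the abstract isomorphism φ is needed.
  have hss (h : T) : (f h).IsSemisimple := by
    obtain ⟨u, hu⟩ := mem_diagonalSubgroup_iff_exists.1 (φ h).2
    obtain ⟨m, hm, hpow⟩ := exists_pow_card_pow_eq k (Set.range fun i => (u i : K))
      (Set.finite_range _)
    have h1 : φ h ^ Fintype.card k ^ m = φ h := by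
      apply Subtype.ext
      apply Units.ext
      rw [Subgroup.coe_pow, Units.val_pow_eq_pow_val, ← hu, val_diagonalGL, Matrix.diagonal_pow]
      congr 1
      funext i
      exact hpow _ ⟨i, rfl⟩
    rw [← map_pow] at h1
    have h2 := congrArg (fun y : T => y.val.val) (φ.injective h1)
    simp only [Subgroup.coe_pow, Units.val_pow_eq_pow_val] at h2
    refine Module.End.isSemisimple_of_squarefree_aeval_eq_zero
      (separable_X_pow_card_pow_sub_X k hm).squarefree ?_
    rw [map_sub, map_pow, Polynomial.aeval_X, ← Matrix.toLin'_pow, h2, sub_self]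
  have htop :=
    Module.End.iSup_iInf_maxGenEigenspace_eq_top_of_iSup_maxGenEigenspace_eq_top_of_commute
    f hcomm fun h => Module.End.iSup_maxGenEigenspace_eq_top (f h)
  -- Common eigenvectors of T; they span because the commuting maps have only genuine eigenspaces,
  -- so a basis g can be chosen among them.
  let S : Set (Fin n → K) := {v | ∀ h : T, ∃ c : K, f h v = c • v}
  have hS : Submodule.span K S = ⊤ := by
    rw [eq_top_iff, ← htop]
    refine iSup_le fun χ v hv => Submodule.subset_span fun h => ⟨χ h, ?_⟩
    have hv' := (Submodule.mem_iInf _).1 hv h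
    rw [(hss h).isFinitelySemisimple.maxGenEigenspace_eq_eigenspace] at hv'
    exact Module.End.mem_eigenspace_iff.1 hv'
  obtain ⟨g, hg⟩ := exists_generalLinearGroup_col_mem S hS
  refine ⟨g, fun x hx => ?_⟩
  rw [mem_map_conj_iff, mem_diagonalSubgroup_iff]
  intro i j hij
  obtain ⟨c, hc⟩ := hg j ⟨x, hx⟩
  have hcol : (x.val * g.val).col j = c • g.val.col j := hc
  have h1 : ((g⁻¹).val * g.val) i j = 0 := by
    rw [← Units.val_mul, inv_mul_cancel, Units.val_one, Matrix.one_apply_ne hij]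
  rw [mul_assoc, Units.val_mul, Units.val_mul, Matrix.mul_apply]
  rw [Matrix.mul_apply] at h1
  rw [← mul_zero c, ← h1, Finset.mul_sum]
  refine Finset.sum_congr rfl fun l _ => ?_
  have h2 : (x.val * g.val) l j = c * g.val l j := congrFun hcol l
  rw [h2]
  ring

/-- Every torus lies in a conjugate of D_n, and one conjugate contained in another equals it. -/
theorem isMaximalTorus_iff (k : Type*) [Field k] [Fintype k] [Algebra k K]
    [Algebra.IsAlgebraic k K] [IsAlgClosed K]
    {T : Subgroup (Matrix.GeneralLinearGroup (Fin n) K)} :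
    IsMaximalTorus T ↔ ∃ g, T = (diagonalSubgroup n K).map (MulAut.conj g).toMonoidHom := by
  have : Infinite K := inferInstance
  constructor
  · intro h
    obtain ⟨g, hg⟩ := h.prop.exists_le_map_conj k
    exact ⟨g, h.eq_of_le (isTorus_map_conj_diagonalSubgroup g) hg⟩
  · rintro ⟨g, rfl⟩
    refine ⟨isTorus_map_conj_diagonalSubgroup g, fun T' hT' hle => ?_⟩
    obtain ⟨h, hh⟩ := hT'.exists_le_map_conj k
    rw [eq_of_map_conj_le_map_conj (hle.trans hh)]
    exact hh

end Tori

/-! ### Permutation matrices and monomial decomposition -/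

section PermutationMatrices

variable {K : Type*} [Field K] {n : ℕ}

theorem diagonalGL_injective : Function.Injective (diagonalGL : (Fin n → Kˣ) → _) := by
  intro u v h
  have h1 := congrArg Units.val h
  rw [val_diagonalGL, val_diagonalGL, Matrix.diagonal_eq_diagonal_iff] at h1
  exact funext fun i => Units.ext (h1 i)

variable (K) in
/-- The permutation matrix of `σ` as an invertible matrix. -/
noncomputable def permGL (σ : Equiv.Perm (Fin n)) : Matrix.GeneralLinearGroup (Fin n) K where
  val := σ.permMatrix K
  inv := σ⁻¹.permMatrix K
  val_inv := by rw [← Matrix.permMatrix_mul, inv_mul_cancel, Matrix.permMatrix_one]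
  inv_val := by rw [← Matrix.permMatrix_mul, mul_inv_cancel, Matrix.permMatrix_one]

theorem val_permGL (σ : Equiv.Perm (Fin n)) : (permGL K σ).val = σ.permMatrix K := rfl

theorem permGL_apply (σ : Equiv.Perm (Fin n)) (i j : Fin n) :
    (permGL K σ).val i j = if σ i = j then 1 else 0 := by
  simp [val_permGL, PEquiv.toMatrix_apply, Equiv.toPEquiv_apply]

theorem permGL_mul (σ τ : Equiv.Perm (Fin n)) :
    permGL K (σ * τ) = permGL K τ * permGL K σ :=
  Units.ext (Matrix.permMatrix_mul σ τ)

theorem isMonomialMatrix_permGL (σ : Equiv.Perm (Fin n)) :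
    IsMonomialMatrix σ (permGL K σ).val := by
  intro i j h
  rw [permGL_apply] at h
  by_contra h0
  exact h (if_neg h0)

theorem isMonomialMatrix_diagonalGL (u : Fin n → Kˣ) :
    IsMonomialMatrix 1 (diagonalGL u).val := by
  intro i j h
  rw [val_diagonalGL] at h
  by_contra h0
  exact h (Matrix.diagonal_apply_ne _ h0)

theorem IsMonomialMatrix.exists_eq_diagonalGL_mul {σ : Equiv.Perm (Fin n)}
    {a : Matrix.GeneralLinearGroup (Fin n) K} (h : IsMonomialMatrix σ a.val) :
    ∃ u, a = diagonalGL u * permGL K σ := by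
  refine ⟨fun i => Units.mk0 _ (h.apply_ne_zero i), ?_⟩
  ext i j
  rw [Units.val_mul, val_diagonalGL, Matrix.diagonal_mul, permGL_apply]
  split_ifs with hij
  · simp [hij]
  · rw [h.apply_eq_zero hij, mul_zero]

theorem IsMonomialMatrix.inv [Infinite K] {σ : Equiv.Perm (Fin n)}
    {a : Matrix.GeneralLinearGroup (Fin n) K} (h : IsMonomialMatrix σ a.val) :
    IsMonomialMatrix σ⁻¹ (a⁻¹).val := by
  have h1 : (diagonalSubgroup n K).map (MulAut.conj a⁻¹).toMonoidHom = diagonalSubgroup n K := by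
    conv_lhs => rw [← h.map_conj_diagonalSubgroup]
    rw [← map_conj_mul, inv_mul_cancel]
    ext x
    simp
  obtain ⟨τ, hτ⟩ := exists_isMonomialMatrix_of_map_conj h1
  have h2 := h.mul hτ
  rw [← Units.val_mul, mul_inv_cancel] at h2
  have h3 : IsMonomialMatrix 1 (1 : Matrix.GeneralLinearGroup (Fin n) K).val := by
    intro i j hij
    by_contra h0
    exact hij (Matrix.one_apply_ne h0)
  rw [inv_eq_of_mul_eq_one_left (h2.unique h3)]
  exact hτ

end PermutationMatrices

/-! ### F-stable tori, their types and frames -/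

section Frobenius

variable (k : Type*) [Field k] [Fintype k] {K : Type*} [Field K] [Algebra k K] {n : ℕ}

theorem IsMonomialMatrix.frobeniusGL {σ : Equiv.Perm (Fin n)}
    {a : Matrix.GeneralLinearGroup (Fin n) K} (h : IsMonomialMatrix σ a.val) :
    IsMonomialMatrix σ (frobeniusGL k n a).val := by
  intro i j hij
  refine h i j fun h0 => hij ?_
  rw [frobeniusGL_apply, h0, zero_pow Fintype.card_ne_zero]

theorem frobeniusGL_diagonalGL (u : Fin n → Kˣ) :
    frobeniusGL k n (diagonalGL u) = diagonalGL (u ^ Fintype.card k) := by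
  ext i j
  rw [frobeniusGL_apply, val_diagonalGL, val_diagonalGL]
  by_cases hij : i = j
  · subst hij; simp
  · rw [Matrix.diagonal_apply_ne _ hij, Matrix.diagonal_apply_ne _ hij,
      zero_pow Fintype.card_ne_zero]

theorem frobeniusGL_permGL (σ : Equiv.Perm (Fin n)) :
    frobeniusGL k n (permGL K σ) = permGL K σ := by
  ext i j
  rw [frobeniusGL_apply, permGL_apply]
  split_ifs <;> simp

/-- The cycle type of a permutation of `Fin n`, including the fixed points, as a partition. -/
def permPartition (σ : Equiv.Perm (Fin n)) : n.Partition where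
  parts := σ.partition.parts
  parts_pos := σ.partition.parts_pos
  parts_sum := σ.partition.parts_sum.trans (Fintype.card_fin n)

theorem permPartition_eq_of_isConj {σ τ : Equiv.Perm (Fin n)} (h : IsConj σ τ) :
    permPartition σ = permPartition τ := by
  have h1 := congrArg Nat.Partition.parts (Equiv.Perm.partition_eq_of_isConj.1 h)
  exact Nat.Partition.ext h1

theorem isTorusOfType_iff {T : Subgroup (Matrix.GeneralLinearGroup (Fin n) K)}
    {lam : n.Partition} :
    IsTorusOfType k T lam ↔ ∃ g σ,
      T = (diagonalSubgroup n K).map (MulAut.conj g).toMonoidHom ∧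
        IsMonomialMatrix σ (g⁻¹ * frobeniusGL k n g).val ∧ permPartition σ = lam := by
  simp only [Nat.Partition.ext_iff]
  constructor
  · rintro ⟨g, σ, d, hT, hg, hσ⟩
    exact ⟨g, σ, hT, hg ▸ isMonomialMatrix_permMatrix_mul σ d, hσ⟩
  · rintro ⟨g, σ, hT, hg, hσ⟩
    exact ⟨g, σ, _, hT, hg.eq_permMatrix_mul, hσ⟩

theorem isMonomialMatrix_of_frobeniusGL_eq {g : Matrix.GeneralLinearGroup (Fin n) K}
    {σ : Equiv.Perm (Fin n)} (h : frobeniusGL k n g = g * permGL K σ) :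
    IsMonomialMatrix σ (g⁻¹ * frobeniusGL k n g).val := by
  rw [h, inv_mul_cancel_left]
  exact isMonomialMatrix_permGL σ

theorem exists_map_algebraMap_of_frobeniusGL_eq {x : Matrix.GeneralLinearGroup (Fin n) K}
    (hx : frobeniusGL k n x = x) :
    ∃ y, Matrix.GeneralLinearGroup.map (algebraMap k K) y = x := by
  have h (i j) : x.val i j ∈ Set.range (algebraMap k K) :=
    mem_range_algebraMap_of_pow_card_eq k (by rw [← frobeniusGL_apply, hx])
  choose B hB using h
  have hBx : (Matrix.of B).map (algebraMap k K) = x.val := by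
    ext i j
    exact hB i j
  have hdet : (Matrix.of B).det ≠ 0 := by
    intro h0
    refine (Matrix.isUnit_iff_isUnit_det _ |>.1 x.isUnit).ne_zero ?_
    rw [← hBx, ← RingHom.mapMatrix_apply, ← RingHom.map_det, h0, map_zero]
  exact ⟨Matrix.GeneralLinearGroup.mkOfDetNeZero _ hdet, Units.ext hBx⟩

theorem frobeniusGL_map_algebraMap (y : Matrix.GeneralLinearGroup (Fin n) k) :
    frobeniusGL k n (Matrix.GeneralLinearGroup.map (algebraMap k K) y) =
      Matrix.GeneralLinearGroup.map (algebraMap k K) y := by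
  ext i j
  rw [frobeniusGL_apply]
  simp [← map_pow, FiniteField.pow_card]

variable [IsAlgClosed K]

/-- With w = g⁻¹ h in the normalizer, h⁻¹ F(h) = w⁻¹ (g⁻¹ F(g)) F(w), and F(w) has the same
permutation as w. This makes the type well defined. -/
theorem isConj_of_map_conj_eq {g h : Matrix.GeneralLinearGroup (Fin n) K}
    {σ τ : Equiv.Perm (Fin n)}
    (hgh : (diagonalSubgroup n K).map (MulAut.conj g).toMonoidHom =
      (diagonalSubgroup n K).map (MulAut.conj h).toMonoidHom)
    (hg : IsMonomialMatrix σ (g⁻¹ * frobeniusGL k n g).val)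
    (hh : IsMonomialMatrix τ (h⁻¹ * frobeniusGL k n h).val) : IsConj σ τ := by
  have : Infinite K := inferInstance
  obtain ⟨ρ, hρ⟩ := exists_isMonomialMatrix_of_map_conj ((map_conj_eq_iff _ g h).1 hgh)
  have h1 := (hρ.inv.mul hg).mul (hρ.frobeniusGL k)
  rw [← Units.val_mul, ← Units.val_mul] at h1
  have h2 : (g⁻¹ * h)⁻¹ * (g⁻¹ * frobeniusGL k n g) * frobeniusGL k n (g⁻¹ * h) =
      h⁻¹ * frobeniusGL k n h := by
    simp [mul_assoc]
  rw [h2] at h1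
  rw [isConj_iff]
  exact ⟨ρ, by rw [mul_assoc]; exact h1.unique hh⟩

theorem map_frobeniusGL_diagonalSubgroup :
    (diagonalSubgroup n K).map (frobeniusGL k n) = diagonalSubgroup n K := by
  ext x
  simp only [Subgroup.mem_map, mem_diagonalSubgroup_iff_exists]
  constructor
  · rintro ⟨_, ⟨u, rfl⟩, rfl⟩
    exact ⟨_, (frobeniusGL_diagonalGL k u).symm⟩
  · rintro ⟨u, rfl⟩
    have hroot (i) : ∃ w : Kˣ, w ^ Fintype.card k = u i := by
      obtain ⟨z, hz⟩ := IsAlgClosed.exists_pow_nat_eq (u i : K) (Fintype.card_pos (α := k))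
      have hz0 : z ≠ 0 := by
        rintro rfl
        rw [zero_pow Fintype.card_ne_zero] at hz
        exact (u i).ne_zero hz.symm
      exact ⟨Units.mk0 z hz0, Units.ext hz⟩
    choose w hw using hroot
    exact ⟨_, ⟨w, rfl⟩, by rw [frobeniusGL_diagonalGL]; exact congrArg _ (funext hw)⟩

theorem map_frobeniusGL_map_conj (g : Matrix.GeneralLinearGroup (Fin n) K) :
    ((diagonalSubgroup n K).map (MulAut.conj g).toMonoidHom).map (frobeniusGL k n) =
      (diagonalSubgroup n K).map (MulAut.conj (frobeniusGL k n g)).toMonoidHom := by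
  conv_rhs => rw [← map_frobeniusGL_diagonalSubgroup k]
  rw [Subgroup.map_map, Subgroup.map_map]
  congr 1
  ext1 x
  simp

variable (K n) in
/-- Pairs `(σ, g)` such that `g⁻¹ F(g)` is the permutation matrix of `σ`. -/
def frobeniusFrames : Set (Equiv.Perm (Fin n) × Matrix.GeneralLinearGroup (Fin n) K) :=
  {p | frobeniusGL k n p.2 = p.2 * permGL K p.1}

/-- The pairs `(σ, g)` giving a fixed torus, in terms of one of them. -/
theorem nonempty_equiv_frobeniusFrames_fiber {g : Matrix.GeneralLinearGroup (Fin n) K}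
    {σ : Equiv.Perm (Fin n)} (hg : frobeniusGL k n g = g * permGL K σ) :
    Nonempty (Equiv.Perm (Fin n) ×
        {u : Fin n → Kˣ // ∀ i, u (σ i) ^ Fintype.card k = u i} ≃
      {p : Equiv.Perm (Fin n) × Matrix.GeneralLinearGroup (Fin n) K //
        p ∈ frobeniusFrames k K n ∧ (diagonalSubgroup n K).map (MulAut.conj p.2).toMonoidHom =
          (diagonalSubgroup n K).map (MulAut.conj g).toMonoidHom}) := by
  have hcomm (u : Fin n → Kˣ) (τ : Equiv.Perm (Fin n)) :
      permGL K σ * frobeniusGL k n (diagonalGL u * permGL K τ) =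
        diagonalGL ((u ^ Fintype.card k) ∘ σ) * permGL K (τ * σ) := by
    rw [map_mul, frobeniusGL_diagonalGL, frobeniusGL_permGL, ← mul_assoc,
      (isMonomialMatrix_permGL σ).mul_diagonalGL, mul_assoc, ← permGL_mul]
  -- Any h giving the same torus is g w with w = diag(u) P_τ. The equation F(h) = h P_ρ becomes P_σ
  -- F(w) = w P_ρ; comparing diagonal and permutation parts gives u(σ i)^q = u(i) and ρ = τ σ τ⁻¹.
  refine ⟨Equiv.ofBijective (fun x => ⟨(x.1 * σ * x.1⁻¹, g * (diagonalGL x.2.1 * permGL K x.1)),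
    ?_, ?_⟩) ⟨?_, ?_⟩⟩
  · obtain ⟨τ, u, hu⟩ := x
    change frobeniusGL k n (g * (diagonalGL u * permGL K τ)) =
      g * (diagonalGL u * permGL K τ) * permGL K (τ * σ * τ⁻¹)
    rw [map_mul, hg, mul_assoc g, hcomm u τ, mul_assoc g, mul_assoc (diagonalGL u),
      ← permGL_mul, inv_mul_cancel_right, show (u ^ Fintype.card k) ∘ σ = u from funext hu]
  · rw [map_conj_mul, map_conj_mul,
      (isMonomialMatrix_permGL x.1).map_conj_diagonalSubgroup,
      (isMonomialMatrix_diagonalGL x.2.1).map_conj_diagonalSubgroup]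
  · rintro ⟨τ, u, hu⟩ ⟨τ', u', hu'⟩ h
    have h1 : diagonalGL u * permGL K τ = diagonalGL u' * permGL K τ' :=
      mul_left_cancel (congrArg (fun p => p.1.2) h)
    have h2 := (isMonomialMatrix_diagonalGL u).mul (isMonomialMatrix_permGL τ)
    have h3 := (isMonomialMatrix_diagonalGL u').mul (isMonomialMatrix_permGL τ')
    rw [← Units.val_mul, mul_one] at h2 h3
    rw [h1] at h2
    obtain rfl := h2.unique h3
    obtain rfl := diagonalGL_injective (mul_right_cancel h1)
    rfl
  · rintro ⟨⟨ρ, h⟩, hh, hT⟩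
    have hh' : frobeniusGL k n h = h * permGL K ρ := hh
    have : Infinite K := inferInstance
    obtain ⟨τ, hτ⟩ := exists_isMonomialMatrix_of_map_conj ((map_conj_eq_iff _ g h).1 hT.symm)
    obtain ⟨u, hu⟩ := hτ.exists_eq_diagonalGL_mul
    have h1 : h = g * (diagonalGL u * permGL K τ) := by rw [← hu, mul_inv_cancel_left]
    have h2 : diagonalGL ((u ^ Fintype.card k) ∘ σ) * permGL K (τ * σ) =
        diagonalGL u * permGL K (ρ * τ) := by
      rw [← hcomm u τ, permGL_mul, ← mul_assoc (diagonalGL u), ← hu]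
      refine mul_left_cancel (a := g) ?_
      rw [← mul_assoc, ← hg, ← map_mul, mul_inv_cancel_left, hh', mul_assoc,
        mul_inv_cancel_left]
    have h3 := (isMonomialMatrix_diagonalGL ((u ^ Fintype.card k) ∘ σ)).mul
      (isMonomialMatrix_permGL (τ * σ))
    have h4 := (isMonomialMatrix_diagonalGL u).mul (isMonomialMatrix_permGL (ρ * τ))
    rw [← Units.val_mul, mul_one] at h3 h4
    rw [h2] at h3
    have h5 := h3.unique h4
    rw [h5] at h2
    have h6 := diagonalGL_injective (mul_right_cancel h2)
    refine ⟨(τ, ⟨u, congrFun h6⟩), Subtype.ext (Prod.ext ?_ h1.symm)⟩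
    exact mul_inv_eq_of_eq_mul h5

variable [Algebra.IsAlgebraic k K]

/-- F sends g D_n g⁻¹ to F(g) D_n F(g)⁻¹, so stability means that g⁻¹ F(g) normalizes D_n. -/
theorem mem_stableMaximalTori_iff {T : Subgroup (Matrix.GeneralLinearGroup (Fin n) K)} :
    T ∈ stableMaximalTori k K n ↔ ∃ g σ,
      T = (diagonalSubgroup n K).map (MulAut.conj g).toMonoidHom ∧
        IsMonomialMatrix σ (g⁻¹ * frobeniusGL k n g).val := by
  have key (g : Matrix.GeneralLinearGroup (Fin n) K) :
      ((diagonalSubgroup n K).map (MulAut.conj g).toMonoidHom).map (frobeniusGL k n) =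
        (diagonalSubgroup n K).map (MulAut.conj g).toMonoidHom ↔
      (diagonalSubgroup n K).map (MulAut.conj (g⁻¹ * frobeniusGL k n g)).toMonoidHom =
        diagonalSubgroup n K := by
    rw [map_frobeniusGL_map_conj, eq_comm, map_conj_eq_iff]
  constructor
  · rintro ⟨hT, hF⟩
    obtain ⟨g, rfl⟩ := (isMaximalTorus_iff k).1 hT
    obtain ⟨σ, hσ⟩ := exists_isMonomialMatrix_of_map_conj ((key g).1 hF)
    exact ⟨g, σ, rfl, hσ⟩
  · rintro ⟨g, σ, rfl, hσ⟩
    exact ⟨(isMaximalTorus_iff k).2 ⟨g, rfl⟩, (key g).2 hσ.map_conj_diagonalSubgroup⟩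

theorem existsUnique_isTorusOfType {T : Subgroup (Matrix.GeneralLinearGroup (Fin n) K)}
    (hT : T ∈ stableMaximalTori k K n) : ∃! lam : n.Partition, IsTorusOfType k T lam := by
  obtain ⟨g, σ, rfl, hg⟩ := (mem_stableMaximalTori_iff k).1 hT
  refine ⟨permPartition σ, (isTorusOfType_iff k).2 ⟨g, σ, rfl, hg, rfl⟩, ?_⟩
  intro lam h
  obtain ⟨h, τ, hT', hh, rfl⟩ := (isTorusOfType_iff k).1 h
  exact (permPartition_eq_of_isConj (isConj_of_map_conj_eq k hT' hg hh)).symm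

theorem torusType_eq {g : Matrix.GeneralLinearGroup (Fin n) K} {σ : Equiv.Perm (Fin n)}
    (hg : IsMonomialMatrix σ (g⁻¹ * frobeniusGL k n g).val) :
    torusType k ((diagonalSubgroup n K).map (MulAut.conj g).toMonoidHom) = permPartition σ := by
  have hex : ∃ lam : n.Partition,
      IsTorusOfType k ((diagonalSubgroup n K).map (MulAut.conj g).toMonoidHom) lam :=
    ⟨_, (isTorusOfType_iff k).2 ⟨g, σ, rfl, hg, rfl⟩⟩
  rw [torusType, dif_pos hex]
  exact (existsUnique_isTorusOfType k ((mem_stableMaximalTori_iff k).2 ⟨g, σ, rfl, hg⟩)).unique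
    hex.choose_spec ((isTorusOfType_iff k).2 ⟨g, σ, rfl, hg, rfl⟩)

/-- A semilinear map with monomial matrix has a fixed vector without zero coordinates. -/
theorem IsMonomialMatrix.exists_frobenius_fixed_units {σ : Equiv.Perm (Fin n)}
    {a : Matrix.GeneralLinearGroup (Fin n) K} (ha : IsMonomialMatrix σ a.val) :
    ∃ u : Fin n → Kˣ, ∀ i, a.val i (σ i) * (u (σ i) : K) ^ Fintype.card k = u i := by
  have hfix (v : Fin n → K) (hv : frobeniusMulVec k a.val v = v) (i) :
      a.val i (σ i) * v (σ i) ^ Fintype.card k = v i := by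
    have h1 := congrFun hv i
    rw [frobeniusMulVec_apply, Finset.sum_eq_single (σ i)] at h1
    · exact h1
    · intro j _ hj
      rw [ha.apply_eq_zero hj.symm, zero_mul]
    · simp
  -- Otherwise all fixed vectors would lie in the hyperplane v_i = 0, although they span.
  have hex (i) : ∃ v, frobeniusMulVec k a.val v = v ∧ v i ≠ 0 := by
    by_contra! h
    have h1 : Submodule.span K {v | frobeniusMulVec k a.val v = v} ≤
        (LinearMap.proj i : (Fin n → K) →ₗ[K] K).ker := Submodule.span_le.2 fun v hv => h v hv
    rw [span_frobeniusMulVec_fixed_eq_top k a.isUnit] at h1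
    have h2 := h1 (Submodule.mem_top (x := Pi.single i 1))
    simp at h2
  choose v hv hvi using hex
  -- The equations couple coordinates only within a cycle, so a different fixed vector may be used
  -- on each cycle: one that is nonzero at its representative, hence along the whole cycle.
  let rep : Fin n → Fin n := fun i => (Quotient.mk (Equiv.Perm.SameCycle.setoid σ) i).out
  have hrep (i) : σ.SameCycle (rep i) i := Quotient.exact (s := Equiv.Perm.SameCycle.setoid σ)
    (Quotient.out_eq _)
  have hrep' (i) : rep (σ i) = rep i := by
    refine congrArg Quotient.out (Quotient.sound ?_)
    exact (Equiv.Perm.sameCycle_apply_left).2 (Equiv.Perm.SameCycle.refl σ i)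
  have hpow (i) (j : ℕ) : v i ((σ ^ j) i) ≠ 0 := by
    induction j with
    | zero => exact hvi i
    | succ j ih =>
      intro h0
      apply ih
      rw [← hfix _ (hv i), ← Equiv.Perm.mul_apply, ← pow_succ', h0,
        zero_pow Fintype.card_ne_zero, mul_zero]
  have hne (i) : v (rep i) i ≠ 0 := by
    obtain ⟨j, -, hj⟩ := (hrep i).exists_pow_eq'
    have h1 := hpow (rep i) j
    rwa [hj] at h1
  refine ⟨fun i => Units.mk0 _ (hne i), fun i => ?_⟩
  simp only [Units.val_mk0, hrep']
  exact hfix _ (hv _) i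

/-- Replacing g by g diag(u) keeps the torus; the fixed vector u without zeros absorbs the diagonal
part of g⁻¹ F(g). -/
theorem exists_frobeniusGL_eq_mul_permGL {g : Matrix.GeneralLinearGroup (Fin n) K}
    {σ : Equiv.Perm (Fin n)} (hg : IsMonomialMatrix σ (g⁻¹ * frobeniusGL k n g).val) :
    ∃ h, (diagonalSubgroup n K).map (MulAut.conj h).toMonoidHom =
        (diagonalSubgroup n K).map (MulAut.conj g).toMonoidHom ∧
      frobeniusGL k n h = h * permGL K σ := by
  obtain ⟨u, hu⟩ := hg.exists_frobenius_fixed_units k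
  refine ⟨g * diagonalGL u, ?_, ?_⟩
  · rw [map_conj_mul, (isMonomialMatrix_diagonalGL u).map_conj_diagonalSubgroup]
  · rw [map_mul, mul_assoc, ← inv_mul_eq_iff_eq_mul, ← mul_assoc, frobeniusGL_diagonalGL]
    ext i j
    rw [Units.val_mul _ (permGL K σ), Units.val_mul _ (diagonalGL _), val_diagonalGL,
      val_diagonalGL, Matrix.diagonal_mul, Matrix.mul_diagonal, permGL_apply]
    split_ifs with hij
    · rw [← hij, mul_one, ← hu]
      rfl
    · rw [hg.apply_eq_zero hij, zero_mul, mul_zero]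

/-- The fibre of the Lang map over `A` is a coset of `GL_n(k)`. -/
theorem nonempty_equiv_frobeniusGL_eq_mul (A : Matrix.GeneralLinearGroup (Fin n) K) :
    Nonempty (Matrix.GeneralLinearGroup (Fin n) k ≃
      {g : Matrix.GeneralLinearGroup (Fin n) K // frobeniusGL k n g = g * A}) := by
  obtain ⟨g, hg⟩ := exists_frobeniusGL_eq_mul k A
  refine ⟨Equiv.ofBijective (fun y => ⟨Matrix.GeneralLinearGroup.map (algebraMap k K) y * g, by
    rw [map_mul, frobeniusGL_map_algebraMap, hg, mul_assoc]⟩) ⟨fun y y' h => ?_, fun h => ?_⟩⟩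
  · have h1 := mul_right_cancel (congrArg Subtype.val h)
    ext i j
    have h2 := congrArg (fun z => z.val i j) h1
    simpa using h2
  · obtain ⟨y, hy⟩ := exists_map_algebraMap_of_frobeniusGL_eq k (x := h.1 * g⁻¹)
      (by rw [map_mul, map_inv, h.2, hg]; group)
    exact ⟨y, Subtype.ext (by simp [hy])⟩

end Frobenius

/-! ### Counting solutions of u(σ i)^q = u(i) -/

section SemilinearUnits

variable (k : Type*) [Field k] [Fintype k] {K : Type*} [Field K] [Algebra k K]

theorem card_units_pow_card_pow_eq [IsAlgClosed K] {m : ℕ} (hm : 0 < m) :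
    Nat.card {x : Kˣ // x ^ Fintype.card k ^ m = x} = Fintype.card k ^ m - 1 := by
  classical
  have h0 : (0 : K) ∈ frobeniusFixedPoints k K m := by
    rw [mem_frobeniusFixedPoints k hm, zero_pow (pow_ne_zero _ Fintype.card_ne_zero)]
  have h1 : Nat.card {x // x ∈ (frobeniusFixedPoints k K m).erase 0} = Fintype.card k ^ m - 1 := by
    rw [Nat.card_eq_fintype_card, Fintype.card_coe, Finset.card_erase_of_mem h0,
      card_frobeniusFixedPoints k hm]
  rw [← h1]
  refine Nat.card_congr (Equiv.ofBijective (fun x => ⟨x.1.val, ?_⟩) ⟨?_, ?_⟩)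
  · rw [Finset.mem_erase, mem_frobeniusFixedPoints k hm]
    exact ⟨x.1.ne_zero, congrArg Units.val x.2⟩
  · intro x y h
    exact Subtype.ext (Units.ext (congrArg Subtype.val h))
  · rintro ⟨x, hx⟩
    rw [Finset.mem_erase, mem_frobeniusFixedPoints k hm] at hx
    exact ⟨⟨Units.mk0 x hx.1, Units.ext hx.2⟩, rfl⟩

variable {α : Type*}

theorem pow_iterate_eq_of_semilinear {M : Type*} [Monoid M] {q : ℕ} {σ : Equiv.Perm α} {u : α → M}
    (hu : ∀ i, u (σ i) ^ q = u i) (i : α) (j : ℕ) : u ((σ ^ j) i) ^ q ^ j = u i := by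
  induction j with
  | zero => simp
  | succ j ih =>
    rw [pow_succ', Equiv.Perm.mul_apply, pow_succ', pow_mul, hu, ih]

/-- Two exponents taking i to r differ by a multiple of the period of r. Extending a value from r
along its cycle is therefore independent of the exponent chosen. -/
theorem pow_pow_eq_of_pow_apply_eq {M : Type*} [Monoid M] {q : ℕ} {σ : Equiv.Perm α} {i r : α}
    {a b : ℕ} (ha : (σ ^ a) i = r) (hb : (σ ^ b) i = r) {x : M}
    (hx : x ^ q ^ Function.minimalPeriod σ r = x) : x ^ q ^ a = x ^ q ^ b := by
  wlog hab : a ≤ b generalizing a b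
  · exact (this hb ha (le_of_not_ge hab)).symm
  obtain ⟨c, rfl⟩ := Nat.exists_eq_add_of_le' hab
  rw [pow_add, Equiv.Perm.mul_apply, ha] at hb
  have hc : Function.minimalPeriod σ r ∣ c := by
    refine Function.IsPeriodicPt.minimalPeriod_dvd ?_
    rw [Function.IsPeriodicPt, Function.IsFixedPt, ← Equiv.Perm.coe_pow, hb]
  obtain ⟨t, rfl⟩ := hc
  clear hab hb
  have h1 : x ^ q ^ (Function.minimalPeriod σ r * t) = x := by
    induction t with
    | zero => simp
    | succ t ih =>
      rw [Nat.mul_succ, pow_add, pow_mul, ih, hx]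
  rw [pow_add, pow_mul, h1]

/-- On each cycle the value at the representative r determines the rest, via u(i) = u(r)^(q^m) when
σ^m i = r; the only constraint is closing up after one period. -/
theorem nonempty_equiv_semilinear_units [Finite α] {I M : Type*} [Monoid M] (q : ℕ)
    (σ : Equiv.Perm α) (r : I → α)
    (idx : α → I) (hσ : ∀ i, idx (σ i) = idx i) (hr : ∀ c, idx (r c) = c)
    (hs : ∀ i, σ.SameCycle i (r (idx i))) :
    Nonempty ({u : α → M // ∀ i, u (σ i) ^ q = u i} ≃
      ((c : I) → {x : M // x ^ q ^ Function.minimalPeriod σ (r c) = x})) := by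
  have hs' (i) : ∃ j : ℕ, (σ ^ j) i = r (idx i) := by
    obtain ⟨j, -, hj⟩ := (hs i).exists_pow_eq'
    exact ⟨j, hj⟩
  choose m hm using hs'
  refine ⟨Equiv.ofBijective (fun u c => ⟨u.1 (r c), ?_⟩) ⟨?_, ?_⟩⟩
  · conv_rhs => rw [← pow_iterate_eq_of_semilinear u.2 (r c) (Function.minimalPeriod σ (r c))]
    rw [Equiv.Perm.coe_pow, Function.iterate_minimalPeriod]
  · intro u u' h
    refine Subtype.ext (funext fun i => ?_)
    rw [← pow_iterate_eq_of_semilinear u.2 i (m i), ← pow_iterate_eq_of_semilinear u'.2 i (m i), hm]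
    have h1 := congrArg Subtype.val (congrFun h (idx i))
    exact congrArg (· ^ _) h1
  · intro x
    refine ⟨⟨fun i => (x (idx i)).1 ^ q ^ m i, fun i => ?_⟩, funext fun c => ?_⟩
    · change ((x (idx (σ i))).1 ^ _) ^ _ = (x (idx i)).1 ^ _
      rw [hσ, ← pow_mul, ← pow_succ]
      refine pow_pow_eq_of_pow_apply_eq (r := r (idx i)) ?_ (hm i) (x (idx i)).2
      rw [pow_succ, Equiv.Perm.mul_apply, hm, hσ]
    · apply Subtype.ext
      have h1 := hm (r c)
      rw [hr] at h1
      change (x (idx (r c))).1 ^ q ^ m (r c) = x c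
      rw [hr]
      exact (pow_pow_eq_of_pow_apply_eq (a := m (r c)) (b := 0) h1 rfl (x c).2).trans (by simp)

variable [Fintype α] [DecidableEq α]

theorem minimalPeriod_eq_card_support_cycleOf {σ : Equiv.Perm α} {x : α} (hx : σ x ≠ x) :
    Function.minimalPeriod σ x = (σ.cycleOf x).support.card := by
  have hon := Equiv.Perm.isCycleOn_support_cycleOf σ x
  have hmem : x ∈ (σ.cycleOf x).support := by
    rwa [Equiv.Perm.mem_support_cycleOf_iff, and_iff_right (Equiv.Perm.SameCycle.refl _ _),
      Equiv.Perm.mem_support]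
  refine Nat.dvd_antisymm (Function.IsPeriodicPt.minimalPeriod_dvd ?_) ?_
  · rw [Function.IsPeriodicPt, Function.IsFixedPt, ← Equiv.Perm.coe_pow, hon.pow_apply_eq hmem]
  · rw [← hon.pow_apply_eq hmem, Equiv.Perm.coe_pow]
    exact Function.iterate_minimalPeriod

/-- The number of solutions of `u (σ i) ^ q = u i` in terms of the cycle type of `σ`. -/
theorem card_semilinear_units [IsAlgClosed K] (σ : Equiv.Perm α) :
    Nat.card {u : α → Kˣ // ∀ i, u (σ i) ^ Fintype.card k = u i} =
      (σ.partition.parts.map fun l => Fintype.card k ^ l - 1).prod := by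
  have hex (c : σ.cycleFactorsFinset) : ∃ x, x ∈ c.1.support :=
    (Equiv.Perm.mem_cycleFactorsFinset_iff.1 c.2).1.nonempty_support
  choose r hr using hex
  have hrσ (c : σ.cycleFactorsFinset) : σ (r c) ≠ r c := Equiv.Perm.mem_support.1
    (Equiv.Perm.mem_cycleFactorsFinset_support_le c.2 (hr c))
  have hcyc (c : σ.cycleFactorsFinset) : σ.cycleOf (r c) = c.1 :=
    (Equiv.Perm.cycle_is_cycleOf (hr c) c.2).symm
  -- Cycles are indexed by nontrivial cycle factors and fixed points separately, as in the parts of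
  -- `σ.partition`.
  let R : σ.cycleFactorsFinset ⊕ {x // σ x = x} → α := Sum.elim r Subtype.val
  let idx : α → σ.cycleFactorsFinset ⊕ {x // σ x = x} := fun i =>
    if h : σ i = i then Sum.inr ⟨i, h⟩ else Sum.inl ⟨σ.cycleOf i,
      Equiv.Perm.cycleOf_mem_cycleFactorsFinset_iff.2 (Equiv.Perm.mem_support.2 h)⟩
  have hidx (i) (h : σ i ≠ i) : idx i = Sum.inl ⟨σ.cycleOf i,
      Equiv.Perm.cycleOf_mem_cycleFactorsFinset_iff.2 (Equiv.Perm.mem_support.2 h)⟩ := dif_neg h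
  have hidx' (i) (h : σ i = i) : idx i = Sum.inr ⟨i, h⟩ := dif_pos h
  obtain ⟨e⟩ := nonempty_equiv_semilinear_units (M := Kˣ) (Fintype.card k) σ R idx
    (fun i => by
      by_cases h : σ i = i
      · rw [h]
      · have h' : σ (σ i) ≠ σ i := fun h0 => h (σ.injective h0)
        rw [hidx _ h, hidx _ h']
        simp [Equiv.Perm.cycleOf_self_apply])
    (fun c => by
      obtain c | c := c
      · change idx (r c) = _
        rw [hidx _ (hrσ c)]
        simp [hcyc]
      · exact hidx' _ c.2)
    (fun i => by
      by_cases h : σ i = i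
      · rw [hidx' _ h]
        exact Equiv.Perm.SameCycle.refl σ i
      · rw [hidx _ h]
        have h1 := hr ⟨σ.cycleOf i,
          Equiv.Perm.cycleOf_mem_cycleFactorsFinset_iff.2 (Equiv.Perm.mem_support.2 h)⟩
        rw [Equiv.Perm.mem_support_cycleOf_iff] at h1
        exact h1.1)
  rw [Nat.card_congr e, Nat.card_pi, Fintype.prod_sum_type, Equiv.Perm.parts_partition,
    Multiset.map_add, Multiset.prod_add]
  congr 1
  · rw [Equiv.Perm.cycleType_def, Multiset.map_map]
    change _ = ∏ c ∈ σ.cycleFactorsFinset, (Fintype.card k ^ c.support.card - 1)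
    rw [← Finset.prod_coe_sort σ.cycleFactorsFinset]
    refine Fintype.prod_congr _ _ fun c => ?_
    have h1 : Function.minimalPeriod σ (R (Sum.inl c)) = c.1.support.card := by
      rw [← hcyc c]
      exact minimalPeriod_eq_card_support_cycleOf (hrσ c)
    rw [h1, card_units_pow_card_pow_eq]
    exact Finset.card_pos.2 ⟨_, hr c⟩
  · have h1 (c : {x // σ x = x}) : Function.minimalPeriod σ (R (Sum.inr c)) = 1 :=
      Function.minimalPeriod_eq_one_iff_isFixedPt.2 c.2
    have h2 : Fintype.card {x // σ x = x} = Fintype.card α - σ.support.card := by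
      rw [Fintype.card_subtype, ← Finset.card_compl]
      congr 1
      ext x
      simp
    simp only [h1, card_units_pow_card_pow_eq k (K := K) one_pos]
    simp [h2]

end SemilinearUnits

/-! ### Sizes of conjugacy classes in S_n -/

section CountingPermutations

variable {n : ℕ}

theorem filter_two_le_add_replicate (lam : n.Partition) :
    lam.parts.filter (2 ≤ ·) + Multiset.replicate (lam.parts.count 1) 1 = lam.parts := by
  conv_rhs => rw [← Multiset.filter_add_not (2 ≤ ·) lam.parts]
  congr 1
  rw [← Multiset.filter_eq']
  refine Multiset.filter_congr fun x hx => ?_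
  have := lam.parts_pos hx
  omega

theorem sum_filter_two_le (lam : n.Partition) :
    (lam.parts.filter (2 ≤ ·)).sum + lam.parts.count 1 = n := by
  have h := congrArg Multiset.sum (filter_two_le_add_replicate lam)
  rw [Multiset.sum_add, Multiset.sum_replicate, lam.parts_sum] at h
  simpa using h

/-- `cycleType` omits fixed points, but their number is recovered from n. -/
theorem permPartition_eq_iff (σ : Equiv.Perm (Fin n)) (lam : n.Partition) :
    permPartition σ = lam ↔ σ.cycleType = lam.parts.filter (2 ≤ ·) := by
  constructor
  · rintro rfl
    exact Equiv.Perm.filter_parts_partition_eq_cycleType.symm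
  · intro h
    refine Nat.Partition.ext ?_
    rw [← filter_two_le_add_replicate lam]
    change σ.partition.parts = _
    rw [Equiv.Perm.parts_partition, h, ← Equiv.Perm.sum_cycleType, h, Fintype.card_fin]
    congr 2
    have := sum_filter_two_le lam
    omega

/-- The number of permutations with cycle type a given partition. -/
theorem card_permPartition_eq_mul (lam : n.Partition) :
    (Finset.univ.filter fun σ : Equiv.Perm (Fin n) => permPartition σ = lam).card *
      (lam.parts.prod * ∏ i ∈ lam.parts.toFinset, (lam.parts.count i).factorial) =
      n.factorial := by
  have h := Equiv.Perm.card_of_cycleType_mul_eq (Fin n) (lam.parts.filter (2 ≤ ·))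
  have hs := sum_filter_two_le lam
  rw [if_pos ⟨by rw [Fintype.card_fin]; omega, fun a ha => (Multiset.mem_filter.1 ha).2⟩,
    Fintype.card_fin] at h
  simp only [permPartition_eq_iff]
  rw [← h]
  congr 1
  have hprod : (lam.parts.filter (2 ≤ ·)).prod = lam.parts.prod := by
    conv_rhs => rw [← filter_two_le_add_replicate lam]
    simp
  have hcount : ∏ i ∈ lam.parts.toFinset, (lam.parts.count i).factorial =
      (lam.parts.count 1).factorial * ∏ i ∈ (lam.parts.filter (2 ≤ ·)).toFinset,
        ((lam.parts.filter (2 ≤ ·)).count i).factorial := by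
    have hsub : lam.parts.toFinset ⊆ insert 1 (lam.parts.filter (2 ≤ ·)).toFinset := by
      intro i hi
      have hi' := Multiset.mem_toFinset.1 hi
      have := lam.parts_pos hi'
      rw [Finset.mem_insert, Multiset.mem_toFinset, Multiset.mem_filter]
      by_cases h1 : i = 1
      · exact Or.inl h1
      · exact Or.inr ⟨hi', by omega⟩
    rw [Finset.prod_subset hsub, Finset.prod_insert]
    · congr 1
      refine Finset.prod_congr rfl fun i hi => ?_
      rw [Multiset.count_filter_of_pos (Multiset.mem_filter.1 (Multiset.mem_toFinset.1 hi)).2]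
    · simp
    · intro i _ hi
      rw [Multiset.mem_toFinset] at hi
      rw [Multiset.count_eq_zero_of_notMem hi, Nat.factorial_zero]
  rw [hcount, hprod, show n - (lam.parts.filter (2 ≤ ·)).sum = lam.parts.count 1 by omega]
  ring

end CountingPermutations

/-! ### Weights attached to partitions -/

section Weights

open MvPolynomial

/-- The monomial `∏ x_i` over the parts `i` of a partition. -/
noncomputable def partsMonomial (s : Multiset ℕ) : MvPolynomial ℕ+ ℚ :=
  (s.map fun l => X l.toPNat').prod

theorem finprod_X_pow_count {n : ℕ} (lam : n.Partition) :
    ∏ᶠ i : ℕ+, (X i : MvPolynomial ℕ+ ℚ) ^ lam.parts.count (i : ℕ) = partsMonomial lam.parts := by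
  rw [partsMonomial, Finset.prod_multiset_map_count,
    finprod_eq_prod_of_mulSupport_subset (s := lam.parts.toFinset.image Nat.toPNat'),
    Finset.prod_image]
  · refine Finset.prod_congr rfl fun i hi => ?_
    rw [Nat.toPNat'_coe, if_pos (lam.parts_pos (Multiset.mem_toFinset.1 hi))]
  -- `Nat.toPNat'` sends 0 to 1, so injectivity uses that parts are positive.
  · intro i hi j hj hij
    have hi' := lam.parts_pos (Multiset.mem_toFinset.1 hi)
    have hj' := lam.parts_pos (Multiset.mem_toFinset.1 hj)
    have h := congrArg PNat.val hij
    rwa [PNat.toPNat'_coe hi', PNat.toPNat'_coe hj'] at h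
  · intro i hi
    rw [Finset.coe_image]
    refine ⟨i, ?_, PNat.coe_toPNat' i⟩
    rw [Finset.mem_coe, Multiset.mem_toFinset]
    by_contra h0
    exact hi (by simp only [Multiset.count_eq_zero_of_notMem h0, pow_zero])

variable (q : ℕ)

/-- The weight `∏ x_i / (q ^ i - 1)` over the parts `i` of a partition. -/
noncomputable def partsWeight (s : Multiset ℕ) : MvPolynomial ℕ+ ℚ :=
  (s.map fun l => C (1 / ((q : ℚ) ^ l - 1)) * X l.toPNat').prod

theorem cast_pow_sub_one_ne_zero {q l : ℕ} (hq : 1 < q) (hl : 0 < l) : (q : ℚ) ^ l - 1 ≠ 0 := by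
  have h : 1 < (q : ℚ) := by exact_mod_cast hq
  exact (sub_pos.2 (one_lt_pow₀ h hl.ne')).ne'

/-- The denominators of the weight are chosen to cancel the count in `card_semilinear_units`. -/
theorem nsmul_partsWeight {q : ℕ} (hq : 1 < q) {n : ℕ} (lam : n.Partition) :
    (lam.parts.map fun l => q ^ l - 1).prod • partsWeight q lam.parts =
      partsMonomial lam.parts := by
  rw [nsmul_eq_mul, Nat.cast_multiset_prod, Multiset.map_map, partsWeight, partsMonomial,
    ← Multiset.prod_map_mul]
  refine congrArg _ (Multiset.map_congr rfl fun l hl => ?_)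
  have hl' := lam.parts_pos hl
  have h1 : ((q ^ l - 1 : ℕ) : MvPolynomial ℕ+ ℚ) =
      C ((q : ℚ) ^ l - 1) := by
    rw [Nat.cast_sub (Nat.one_le_pow _ _ (Nat.zero_lt_of_lt hq))]
    simp
  rw [Function.comp_apply, h1, ← mul_assoc, ← C_mul,
    mul_one_div_cancel (cast_pow_sub_one_ne_zero hq hl'), C_1, one_mul]

end Weights

/-! ### The cycle index as a sum over partitions -/

section ExpCoeff

open MvPolynomial

variable (q n : ℕ)

/-- The coefficient of `x_i ^ j u ^ (i j)` in `exp (x_i u ^ i / ((q ^ i - 1) i))`. -/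
noncomputable def expCoeff (i j : ℕ) : MvPolynomial ℕ+ ℚ :=
  C (1 / (j.factorial : ℚ)) *
    (C (1 / (((q : ℚ) ^ i - 1) * i)) * X i.toPNat') ^ j

/-- The class with m_i cycles of length i has n! / ∏ i^(m_i) m_i! elements, and this factors over i
into the scalars of `expCoeff`. -/
theorem sum_perm_partsWeight : C (1 / (n.factorial : ℚ)) *
      ∑ σ : Equiv.Perm (Fin n), partsWeight q (permPartition σ).parts =
    ∑ lam : n.Partition, lam.parts.toFinsupp.prod (expCoeff q) := by
  classical
  rw [← Finset.sum_fiberwise_of_maps_to (t := Finset.univ) (g := permPartition)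
    (fun _ _ => Finset.mem_univ _), Finset.mul_sum]
  refine Finset.sum_congr rfl fun lam _ => ?_
  rw [Finset.sum_congr rfl (g := fun _ => partsWeight q lam.parts)
    (fun σ hσ => by rw [(Finset.mem_filter.1 hσ).2]), Finset.sum_const, nsmul_eq_mul,
    ← map_natCast (C : ℚ →+* MvPolynomial ℕ+ ℚ), ← mul_assoc, ← C_mul]
  have hcard := card_permPartition_eq_mul lam
  have hscalar : 1 / (n.factorial : ℚ) *
      (Finset.univ.filter fun σ : Equiv.Perm (Fin n) => permPartition σ = lam).card =
      ∏ i ∈ lam.parts.toFinset,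
        (1 / ((lam.parts.count i).factorial : ℚ) * (1 / (i : ℚ)) ^ lam.parts.count i) := by
    rw [Finset.prod_multiset_count] at hcard
    rw [Finset.prod_mul_distrib, one_div_mul_eq_div, div_eq_iff (by positivity), ← hcard]
    push_cast
    have h1 : (∏ i ∈ lam.parts.toFinset, (1 / ((lam.parts.count i).factorial : ℚ))) *
        ∏ i ∈ lam.parts.toFinset, ((lam.parts.count i).factorial : ℚ) = 1 := by
      rw [← Finset.prod_mul_distrib]
      exact Finset.prod_eq_one fun i _ =>
        one_div_mul_cancel (Nat.cast_ne_zero.2 (Nat.factorial_ne_zero _))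
    have h2 : (∏ i ∈ lam.parts.toFinset, (1 / (i : ℚ)) ^ lam.parts.count i) *
        ∏ i ∈ lam.parts.toFinset, (i : ℚ) ^ lam.parts.count i = 1 := by
      rw [← Finset.prod_mul_distrib]
      refine Finset.prod_eq_one fun i hi => ?_
      have hi' := lam.parts_pos (Multiset.mem_toFinset.1 hi)
      rw [← mul_pow, one_div_mul_cancel (Nat.cast_ne_zero.2 hi'.ne'), one_pow]
    linear_combination -((Finset.univ.filter fun σ : Equiv.Perm (Fin n) =>
      permPartition σ = lam).card : ℚ) * (h2 + h1 * (∏ i ∈ lam.parts.toFinset,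
        (1 / (i : ℚ)) ^ lam.parts.count i) * ∏ i ∈ lam.parts.toFinset,
          (i : ℚ) ^ lam.parts.count i)
  rw [hscalar, partsWeight, Finset.prod_multiset_map_count, map_prod, ← Finset.prod_mul_distrib,
    Finsupp.prod, Multiset.toFinsupp_support]
  refine Finset.prod_congr rfl fun i _ => ?_
  rw [Multiset.toFinsupp_apply, expCoeff, ← one_div_mul_one_div, C_mul, C_mul, C_pow]
  ring

end ExpCoeff

/-! ### Double counting of frames -/

section Frames

open MvPolynomial

variable (k : Type*) [Field k] [Fintype k] (K : Type*) [Field K] [Algebra k K]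
  [Algebra.IsAlgebraic k K] [IsAlgClosed K] (n : ℕ)

theorem finite_frobeniusFrames : (frobeniusFrames k K n).Finite := by
  have hfin (σ : Equiv.Perm (Fin n)) : Finite {g : Matrix.GeneralLinearGroup (Fin n) K //
      frobeniusGL k n g = g * permGL K σ} :=
    (nonempty_equiv_frobeniusGL_eq_mul k (permGL K σ)).elim fun e => Finite.of_equiv _ e
  refine Set.finite_coe_iff.1 (Finite.of_injective (β := Σ σ : Equiv.Perm (Fin n),
    {g : Matrix.GeneralLinearGroup (Fin n) K // frobeniusGL k n g = g * permGL K σ})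
    (fun p => ⟨p.1.1, p.1.2, p.2⟩) ?_)
  rintro ⟨⟨σ, g⟩, hg⟩ ⟨⟨τ, h⟩, hh⟩ heq
  rw [Sigma.mk.injEq] at heq
  obtain ⟨rfl, heq⟩ := heq
  have h1 := congrArg Subtype.val (eq_of_heq heq)
  exact Subtype.ext (Prod.ext rfl h1)

variable {K n} in
/-- The torus `g D_n g⁻¹` of a pair `(σ, g)`. -/
noncomputable def frameTorus (p : Equiv.Perm (Fin n) × Matrix.GeneralLinearGroup (Fin n) K) :
    Subgroup (Matrix.GeneralLinearGroup (Fin n) K) :=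
  (diagonalSubgroup n K).map (MulAut.conj p.2).toMonoidHom

theorem mem_stableMaximalTori_iff_exists_frame
    {T : Subgroup (Matrix.GeneralLinearGroup (Fin n) K)} :
    T ∈ stableMaximalTori k K n ↔ ∃ p ∈ frobeniusFrames k K n, frameTorus p = T := by
  rw [mem_stableMaximalTori_iff]
  constructor
  · rintro ⟨g, σ, rfl, hg⟩
    obtain ⟨h, hT, hh⟩ := exists_frobeniusGL_eq_mul_permGL k hg
    exact ⟨(σ, h), hh, hT⟩
  · rintro ⟨⟨σ, g⟩, hg, rfl⟩
    exact ⟨g, σ, rfl, isMonomialMatrix_of_frobeniusGL_eq k hg⟩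

theorem finite_stableMaximalTori : (stableMaximalTori k K n).Finite := by
  refine ((finite_frobeniusFrames k K n).image frameTorus).subset fun T hT => ?_
  exact (mem_stableMaximalTori_iff_exists_frame k K n).1 hT

variable {K n} in
theorem torusType_frameTorus
    {p : Equiv.Perm (Fin n) × Matrix.GeneralLinearGroup (Fin n) K}
    (hp : p ∈ frobeniusFrames k K n) : torusType k (frameTorus p) = permPartition p.1 :=
  torusType_eq k (isMonomialMatrix_of_frobeniusGL_eq k hp)

/-- Frames are grouped by torus: the weight is constant on a fibre, and the fibre size n! ∏ (q^l -
1) clears its denominators. -/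
theorem sum_frobeniusFrames_eq_sum_tori :
    ∑ p ∈ (finite_frobeniusFrames k K n).toFinset,
        partsWeight (Fintype.card k) (permPartition p.1).parts =
      n.factorial • ∑ T ∈ (finite_stableMaximalTori k K n).toFinset,
        partsMonomial (torusType k T).parts := by
  classical
  rw [Finset.smul_sum, ← Finset.sum_fiberwise_of_maps_to
    (s := (finite_frobeniusFrames k K n).toFinset)
    (t := (finite_stableMaximalTori k K n).toFinset) (g := frameTorus)]
  · refine Finset.sum_congr rfl fun T hT => ?_
    rw [Set.Finite.mem_toFinset, mem_stableMaximalTori_iff_exists_frame] at hT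
    obtain ⟨p, hp, rfl⟩ := hT
    rw [Finset.sum_congr rfl (g := fun _ =>
      partsWeight (Fintype.card k) (torusType k (frameTorus p)).parts)]
    · rw [Finset.sum_const, ← nsmul_partsWeight (Fintype.one_lt_card (α := k)), smul_smul]
      congr 1
      obtain ⟨e⟩ := nonempty_equiv_frobeniusFrames_fiber k hp
      have hcard := Nat.card_congr e
      rw [Nat.card_prod, card_semilinear_units, Nat.card_perm, Nat.card_fin] at hcard
      rw [torusType_frameTorus k hp]
      refine Eq.trans ?_ hcard.symm
      refine (Nat.subtype_card _ fun r => ?_).symm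
      rw [Finset.mem_filter, Set.Finite.mem_toFinset]
      rfl
    · intro r hr
      rw [Finset.mem_filter, Set.Finite.mem_toFinset] at hr
      rw [← hr.2, torusType_frameTorus k hr.1]
  · intro p hp
    rw [Set.Finite.mem_toFinset, mem_stableMaximalTori_iff_exists_frame]
    exact ⟨p, (Set.Finite.mem_toFinset _).1 hp, rfl⟩

/-- Frames are grouped by σ: by Lang's theorem every fibre has |GL_n(k)| elements. -/
theorem sum_frobeniusFrames_eq_sum_perm :
    ∑ p ∈ (finite_frobeniusFrames k K n).toFinset,
        partsWeight (Fintype.card k) (permPartition p.1).parts =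
      Nat.card (Matrix.GeneralLinearGroup (Fin n) k) •
        ∑ σ : Equiv.Perm (Fin n), partsWeight (Fintype.card k) (permPartition σ).parts := by
  classical
  rw [Finset.smul_sum, ← Finset.sum_fiberwise_of_maps_to
    (s := (finite_frobeniusFrames k K n).toFinset) (t := Finset.univ) (g := Prod.fst)
    (fun _ _ => Finset.mem_univ _)]
  refine Finset.sum_congr rfl fun σ _ => ?_
  rw [Finset.sum_congr rfl (g := fun _ => partsWeight (Fintype.card k) (permPartition σ).parts)
    fun p hp => by rw [(Finset.mem_filter.1 hp).2], Finset.sum_const]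
  congr 1
  obtain ⟨e⟩ := nonempty_equiv_frobeniusGL_eq_mul k (permGL K σ)
  let e' : {g : Matrix.GeneralLinearGroup (Fin n) K // frobeniusGL k n g = g * permGL K σ} ≃
      {p // p ∈ frobeniusFrames k K n ∧ p.1 = σ} :=
    { toFun := fun g => ⟨(σ, g.1), g.2, rfl⟩
      invFun := fun p => ⟨p.1.2, p.2.1.trans (congrArg (p.1.2 * permGL K ·) p.2.2)⟩
      left_inv := fun g => rfl
      right_inv := fun p => Subtype.ext (Prod.ext p.2.2.symm rfl) }
  rw [Nat.card_congr (e.trans e')]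
  refine (Nat.subtype_card _ fun r => ?_).symm
  rw [Finset.mem_filter, Set.Finite.mem_toFinset]

theorem toriCycleIndex_eq_sum_perm : toriCycleIndex k K n =
    C (1 / (n.factorial : ℚ)) *
      ∑ σ : Equiv.Perm (Fin n), partsWeight (Fintype.card k) (permPartition σ).parts := by
  have h := (sum_frobeniusFrames_eq_sum_tori k K n).symm.trans
    (sum_frobeniusFrames_eq_sum_perm k K n)
  have hcard : (Nat.card (Matrix.GeneralLinearGroup (Fin n) k) : ℚ) ≠ 0 :=
    Nat.cast_ne_zero.2 Nat.card_pos.ne'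
  have hfac : (n.factorial : ℚ) ≠ 0 := Nat.cast_ne_zero.2 n.factorial_ne_zero
  have hsum : ∑ᶠ T ∈ stableMaximalTori k K n, ∏ᶠ i : ℕ+, (X i : MvPolynomial ℕ+ ℚ) ^ numParts k T i
      = ∑ T ∈ (finite_stableMaximalTori k K n).toFinset, partsMonomial (torusType k T).parts := by
    rw [finsum_mem_eq_finite_toFinset_sum _ (finite_stableMaximalTori k K n)]
    exact Finset.sum_congr rfl fun T _ => finprod_X_pow_count _
  rw [toriCycleIndex, hsum]
  simp only [nsmul_eq_mul, ← map_natCast (C : ℚ →+* MvPolynomial ℕ+ ℚ)] at h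
  refine mul_left_cancel₀ (a := C (n.factorial : ℚ)) (by rwa [Ne, C_eq_zero]) ?_
  rw [mul_left_comm, h, ← mul_assoc, ← mul_assoc, ← C_mul, ← C_mul, one_div_mul_cancel hcard,
    mul_one_div_cancel hfac]

end Frames

/-! ### Expansion of the exponential factors -/

section Exponential

variable {R : Type*} [CommRing R] [Algebra ℚ R]

theorem coeff_exp_subst_C_mul_X_pow (a : R) {i : ℕ} (hi : i ≠ 0) (e : ℕ) :
    PowerSeries.coeff e
        ((PowerSeries.exp ℚ).subst (PowerSeries.C a * PowerSeries.X ^ i : PowerSeries R)) =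
      if i ∣ e then algebraMap ℚ R (1 / ((e / i).factorial : ℚ)) * a ^ (e / i) else 0 := by
  have hs : PowerSeries.HasSubst (PowerSeries.C a * PowerSeries.X ^ i : PowerSeries R) :=
    PowerSeries.HasSubst.of_constantCoeff_zero' (by simp [hi])
  rw [PowerSeries.coeff_subst' hs]
  have hterm (d : ℕ) : (PowerSeries.exp ℚ).coeff d •
      ((PowerSeries.C a * PowerSeries.X ^ i : PowerSeries R) ^ d).coeff e =
      if e = i * d then algebraMap ℚ R (1 / (d.factorial : ℚ)) * a ^ d else 0 := by
    rw [mul_pow, ← pow_mul, ← map_pow, PowerSeries.coeff_C_mul, PowerSeries.coeff_X_pow,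
      PowerSeries.coeff_exp, Algebra.smul_def]
    split_ifs <;> simp
  simp only [hterm]
  split_ifs with h
  · obtain ⟨d, rfl⟩ := h
    rw [finsum_eq_single _ d, if_pos rfl, Nat.mul_div_cancel_left _ (Nat.pos_of_ne_zero hi)]
    intro d' hd'
    rw [if_neg]
    intro h0
    exact hd' (Nat.eq_of_mul_eq_mul_left (Nat.pos_of_ne_zero hi) h0).symm
  · refine (finsum_congr fun d => if_neg ?_).trans finsum_zero
    rintro rfl
    exact h ⟨d, rfl⟩

/-- Splitting off the constant term gives the shape of the factors in
`Nat.Partition.hasProd_genFun`. -/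
theorem exp_subst_C_mul_X_pow_eq_tsum [TopologicalSpace R] [T2Space R] (a : R) {i : ℕ}
    (hi : i ≠ 0) :
    (PowerSeries.exp ℚ).subst (PowerSeries.C a * PowerSeries.X ^ i : PowerSeries R) =
      1 + ∑' j : ℕ, (algebraMap ℚ R (1 / ((j + 1).factorial : ℚ)) * a ^ (j + 1)) •
        (PowerSeries.X : PowerSeries R) ^ (i * (j + 1)) := by
  refine (sub_eq_iff_eq_add'.1 (HasSum.tsum_eq ?_).symm)
  rw [PowerSeries.WithPiTopology.hasSum_iff_hasSum_coeff]
  intro e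
  rw [map_sub, coeff_exp_subst_C_mul_X_pow a hi, PowerSeries.coeff_one]
  simp only [map_smul, PowerSeries.coeff_X_pow, smul_eq_mul, mul_ite, mul_one, mul_zero]
  by_cases h : i ∣ e
  · obtain ⟨d, rfl⟩ := h
    rw [if_pos (dvd_mul_right _ _), Nat.mul_div_cancel_left _ (Nat.pos_of_ne_zero hi)]
    cases d with
    | zero => simp [hi]
    | succ d =>
      have h0 : i * (d + 1) ≠ 0 := mul_ne_zero hi d.succ_ne_zero
      rw [if_neg h0, sub_zero]
      convert hasSum_single d ?_ using 1
      · rw [if_pos rfl]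
      · intro d' hd'
        rw [if_neg]
        intro h1
        exact hd' (by simpa [hi] using h1.symm)
  · have h0 : e ≠ 0 := by
      rintro rfl
      exact h (dvd_zero i)
    rw [if_neg h, if_neg h0, sub_zero]
    convert hasSum_zero using 2 with d
    rw [if_neg]
    rintro rfl
    exact h (dvd_mul_right _ _)

end Exponential

/-! ### Assembly of the product formula -/

theorem mainTheorem2 (k : Type*) [Field k] [Fintype k] (K : Type*) [Field K] [Algebra k K]
    [IsAlgClosure k K] :
    (∀ n : ℕ, (stableMaximalTori k K n).Finite ∧
      ∀ T ∈ stableMaximalTori k K n, ∃! lam : n.Partition, IsTorusOfType k T lam) ∧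
    letI : TopologicalSpace (MvPolynomial ℕ+ ℚ) := ⊥
    HasProd
      (fun i : ℕ+ => (PowerSeries.exp ℚ).subst
        (PowerSeries.C (MvPolynomial.C (1 / (((Fintype.card k : ℚ) ^ (i : ℕ) - 1) * (i : ℕ))) *
          MvPolynomial.X i) * PowerSeries.X ^ (i : ℕ) : PowerSeries (MvPolynomial ℕ+ ℚ)))
      (1 + PowerSeries.mk (fun n : ℕ => if 1 ≤ n then toriCycleIndex k K n else 0)) := by
  have : IsAlgClosed K := IsAlgClosure.isAlgClosed k
  have : Algebra.IsAlgebraic k K := IsAlgClosure.isAlgebraic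
  refine ⟨fun n => ⟨finite_stableMaximalTori k K n, fun T hT =>
    existsUnique_isTorusOfType k hT⟩, ?_⟩
  let _ : TopologicalSpace (MvPolynomial ℕ+ ℚ) := ⊥
  have : DiscreteTopology (MvPolynomial ℕ+ ℚ) := ⟨rfl⟩
  have hseries : 1 + PowerSeries.mk (fun n : ℕ => if 1 ≤ n then toriCycleIndex k K n else 0) =
      Nat.Partition.genFun (expCoeff (Fintype.card k)) := by
    ext1 n
    rw [Nat.Partition.coeff_genFun, map_add, PowerSeries.coeff_mk, PowerSeries.coeff_one,
      toriCycleIndex_eq_sum_perm, sum_perm_partsWeight]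
    -- For n = 0 the separate summand 1 matches the empty partition.
    obtain rfl | hn := Nat.eq_zero_or_pos n
    · simp
    · rw [if_neg hn.ne', if_pos (show 1 ≤ n from hn), zero_add]
  rw [hseries]
  have h := Nat.Partition.hasProd_genFun (expCoeff (Fintype.card k))
  -- The product for `genFun` runs over ℕ with factor i belonging to part size i + 1; it is
  -- reindexed by ℕ+.
  rw [← Equiv.pnatEquivNat.hasProd_iff] at h
  refine (congrArg (fun f => HasProd f (Nat.Partition.genFun (expCoeff (Fintype.card k))))
    (funext fun i => ?_)).mp h
  rw [exp_subst_C_mul_X_pow_eq_tsum _ i.ne_zero, Function.comp_apply]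
  simp only [expCoeff, Equiv.pnatEquivNat_apply, PNat.natPred_add_one, PNat.coe_toPNat',
    MvPolynomial.algebraMap_eq]
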